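/- Let $\mathrm{KS}$ denote plain Kolmogorov complexity of binary strings with respect to an arbitrary fixed optimal programming language, let $H(p)=-p\log_2 p-(1-p)\log_2(1-p)$ (with $0\log_2 0=0$), and let $N(p,\tau)=p+\tau-2p\tau$. For $\tau\in(0,1)$ and an $n$-bit string $x$, let $N_\tau(x)$ be the random string obtained from $x$ by changing each bit independently with probability $\tau$. (1) There is a constant $c$ (depending only on the choice of the optimal programming language) such that for all $p\in[0,1/2]$ and $\tau\in(0,1)$ the following holds with $\alpha=H(p)$ and $\beta=H(N(p,\tau))$. For all sufficiently large $n$ and every string $x$ of length $n$ with $\mathrm{KS}(x)\ge\alpha n$, $$\Pr\bigl[\mathrm{KS}(N_\tau(x))\ge \beta n-c\sqrt{n}\,(\log_2 n)^{3/2}\bigr]\ \ge\ 1-\frac1n .$$ (2) The value of $\beta$ is optimal: let $p\in[0,1/2]$, $\tau\in(0,1)$ and $\alpha=H(p)$; if a real number $\beta'$ and a function $f$ with $f(n)/n\to0$ are such that, for all sufficiently large $n$ and every string $x$ of length $n$ with $\mathrm{KS}(x)\ge\alpha n$, $\Pr[\mathrm{KS}(N_\tau(x))\ge\beta' n-f(n)]\ge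 1-\frac1n$, then $\beta'\le H(N(p,\tau))$. -/

import Mathlib

open Filter Topology

noncomputable section

/-- A decompressor (programming language for plain complexity): a partial map from programs to
outputs, both binary strings. It is *optimal* if it is partial computable and, up to an additive
constant, no partial computable decompressor `V` has shorter descriptions: every `V`-description
`q` of `x` can be replaced by a `U`-description of `x` that is at most `c` bits longer, with `c`
depending on `V` only. (With `V` the identity, every string has a `U`-description.) -/
def IsOptimalDecompressor (U : List Bool →. List Bool) : Prop :=
  Partrec U ∧ ∀ V : List Bool →. List Bool, Partrec V →
    ∃ c : ℕ, ∀ q x : List Bool, x ∈ V q → ∃ r : List Bool, x ∈ U r ∧ r.length ≤ q.length + c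

/-- Plain Kolmogorov complexity of `x` with respect to `U`: the minimal length of a program `q`
on which `U` outputs `x`. (The set is nonempty for every `x` when `U` is optimal.) -/
def plainComplexity (U : List Bool →. List Bool) (x : List Bool) : ℕ :=
  sInf {l : ℕ | ∃ q : List Bool, q.length = l ∧ x ∈ U q}

/-- Plain Kolmogorov complexity of an `n`-bit string. -/
def KS (U : List Bool →. List Bool) {n : ℕ} (x : Fin n → Bool) : ℕ :=
  plainComplexity U (List.ofFn x)

/-- Binary Shannon entropy, `-p log₂ p - (1 - p) log₂ (1 - p)`, measured in bits. -/
def entropyBits (p : ℝ) : ℝ := Real.binEntropy p / Real.log 2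

/-- `N(p, τ) = p (1 - τ) + (1 - p) τ = p + τ - 2 p τ`. -/
def noiseParam (p τ : ℝ) : ℝ := p + τ - 2 * p * τ

/-- The probability that `N_τ(x) = y`, where `N_τ` changes every bit of `x` independently with
probability `τ`. -/
def noiseWeight (τ : ℝ) {n : ℕ} (x y : Fin n → Bool) : ℝ :=
  ∏ i, if y i = x i then 1 - τ else τ

/-- The probability of the event `N_τ(x) ∈ E`. -/
def noiseProb (τ : ℝ) {n : ℕ} (x : Fin n → Bool) (E : Set (Fin n → Bool)) : ℝ :=
  ∑ y, E.indicator (noiseWeight τ x) y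

end

/-!
The first part combines three facts.

* *Enumerability* (`IsOptimalDecompressor.KS_le_of_noisy`). Let `A` be the set of `n`-bit strings of
  complexity less than `K`, so that `|A| < 2 ^ K`, and let `B` be the set of strings that the noise
  sends to `A` with probability at least about `1 / n`. After rounding `τ` to a multiple of `1 / n²`
  (`exists_rational_noise`), the set `B` can be enumerated given `O(log n)` bits, so its elements
  have complexity at most `log₂ |B| + O(log n)`. If a string of complexity at least `H(p) n` lies in
  `B`, then `log₂ |B| ≥ H(p) n - O(log n)`.
* *Mrs. Gerber's lemma* (`le_massEntropy_noisy`). If `X` is uniform on `B`, then the entropy of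
  `N_τ(X)` is at least `H(N(p, τ)) n - O(log n)`. As `p` and `τ` are fixed, a linear form is enough:
  the entropy of a noisy bit is a convex function of the entropy of the bit, and a supporting line
  at `H(p)`, of slope `s ∈ [0, 1]`, bounds it from below (`exists_noise_slope`). Affine bounds
  tensorize by the chain rule.
* *Blowing up* (`sum_compl_hammingNhd_le`). A set of probability about `1 / n` has a Hamming
  neighbourhood of radius `r = O(√(n log n))` of probability at least `1 - 1 / n`. Hence `N_τ(X)` is
  concentrated on the `r`-neighbourhood of `A`, which has at most `(n + 1) ^ r |A|` elements, and its
  entropy is at most `K + O(√n (log n) ^ (3 / 2))`.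

Comparing the two entropy bounds gives a contradiction when `K` is the threshold of the theorem.

For optimality let `p < p' < 1 / 2`. By the first part with `p = 0`, a string with independent bits
of parameter `p'` has complexity at least `H(p) n` with high probability. The noise turns it into a
string with independent bits of parameter `q = N(p', τ)`. The mean complexity of such a string is at
most `H(q) n + O(log n)`, since a string is described by its number of ones and its position among
the strings with that number of ones (`IsOptimalDecompressor.KS_le_neg_log`). So `β ≤ H(q)`, and
`p'` can tend to `p`. For `p = 1 / 2` the claim is that strings have complexity at most `n + O(1)`.
-/

noncomputable section

/-! ### The entropy of a noisy bit -/

/-- The logarithmic odds `log (1 + u) - log (1 - u) = 2 artanh u`; with `u = 1 - 2 r` this is the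
derivative of the binary entropy at `r`. -/
def logOdds (u : ℝ) : ℝ := Real.log (1 + u) - Real.log (1 - u)

lemma two_mul_le_logOdds {u : ℝ} (h0 : 0 ≤ u) (h1 : u < 1) : 2 * u ≤ logOdds u := by
  have h := Real.hasSum_log_sub_log_of_abs_lt_one (x := u) (by rw [abs_of_nonneg h0]; exact h1)
  have := le_hasSum h 0 (fun k _ => by positivity)
  simpa [logOdds] using this

lemma logOdds_pos {u : ℝ} (h0 : 0 < u) (h1 : u < 1) : 0 < logOdds u :=
  lt_of_lt_of_le (by linarith) (two_mul_le_logOdds h0.le h1)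

lemma hasDerivAt_logOdds {u : ℝ} (h0 : 0 ≤ u) (h1 : u < 1) :
    HasDerivAt logOdds (2 / (1 - u ^ 2)) u := by
  have a1 : HasDerivAt (fun x : ℝ => Real.log (1 + x)) (1 / (1 + u)) u :=
    ((hasDerivAt_id u).const_add 1).log (by simp; linarith)
  have a2 : HasDerivAt (fun x : ℝ => Real.log (1 - x)) (-1 / (1 - u)) u :=
    ((hasDerivAt_id u).const_sub 1).log (by simp; linarith)
  refine (a1.sub a2).congr_deriv ?_
  have : 1 - u ≠ 0 := by linarith
  have h2 : 1 + u ≠ 0 := by linarith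
  have h3 : 1 - u ^ 2 ≠ 0 := by
    have : 1 - u ^ 2 = (1 - u) * (1 + u) := by ring
    rw [this]; positivity
  field_simp
  ring

lemma antitoneOn_mul_logOdds_div :
    AntitoneOn (fun u : ℝ => (1 - u ^ 2) * logOdds u / u) (Set.Ioo 0 1) := by
  have hd : ∀ u ∈ Set.Ioo (0 : ℝ) 1, HasDerivAt (fun u : ℝ => (1 - u ^ 2) * logOdds u / u)
      ((2 * u - (1 + u ^ 2) * logOdds u) / u ^ 2) u := by
    intro u hu
    have h1 : HasDerivAt (fun u : ℝ => 1 - u ^ 2) (-(2 * u)) u := by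
      simpa using (hasDerivAt_pow 2 u).const_sub 1
    refine ((h1.mul (hasDerivAt_logOdds hu.1.le hu.2)).div (hasDerivAt_id u)
      hu.1.ne').congr_deriv ?_
    have : 1 - u ^ 2 ≠ 0 := by nlinarith [hu.1, hu.2]
    have := hu.1.ne'
    simp only [id, Pi.mul_apply]
    field_simp
    ring
  apply antitoneOn_of_deriv_nonpos (convex_Ioo 0 1)
  · exact fun u hu => (hd u hu).continuousAt.continuousWithinAt
  · rw [interior_Ioo]
    exact fun u hu => (hd u hu).differentiableAt.differentiableWithinAt
  · rw [interior_Ioo]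
    intro u hu
    rw [(hd u hu).deriv]
    apply div_nonpos_of_nonpos_of_nonneg _ (by positivity)
    nlinarith [two_mul_le_logOdds hu.1.le hu.2, hu.1, sq_nonneg u]

/-- The ratio of the derivatives of `r ↦ h (N (r, τ))` and `h` is monotone; this is the convexity
behind Mrs. Gerber's lemma. -/
lemma antitoneOn_logOdds_div {a : ℝ} (ha0 : 0 < a) (ha1 : a ≤ 1) :
    AntitoneOn (fun u : ℝ => logOdds (a * u) / logOdds u) (Set.Ioo 0 1) := by
  have hau : ∀ u ∈ Set.Ioo (0 : ℝ) 1, a * u ∈ Set.Ioo (0 : ℝ) 1 := fun u hu =>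
    ⟨mul_pos ha0 hu.1, lt_of_le_of_lt (mul_le_of_le_one_left hu.1.le ha1) hu.2⟩
  have hd : ∀ u ∈ Set.Ioo (0 : ℝ) 1, HasDerivAt (fun u : ℝ => logOdds (a * u) / logOdds u)
      ((2 / (1 - (a * u) ^ 2) * a * logOdds u - logOdds (a * u) * (2 / (1 - u ^ 2)))
        / logOdds u ^ 2) u := by
    intro u hu
    have h1 : HasDerivAt (fun u : ℝ => a * u) a u := by simpa using (hasDerivAt_id u).const_mul a
    exact ((hasDerivAt_logOdds (hau u hu).1.le (hau u hu).2).comp u h1).div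
      (hasDerivAt_logOdds hu.1.le hu.2) (logOdds_pos hu.1 hu.2).ne'
  apply antitoneOn_of_deriv_nonpos (convex_Ioo 0 1)
  · exact fun u hu => (hd u hu).continuousAt.continuousWithinAt
  · rw [interior_Ioo]
    exact fun u hu => (hd u hu).differentiableAt.differentiableWithinAt
  · rw [interior_Ioo]
    intro u hu
    rw [(hd u hu).deriv]
    apply div_nonpos_of_nonpos_of_nonneg _ (by positivity)
    have hw := hau u hu
    have h := antitoneOn_mul_logOdds_div hw hu (mul_le_of_le_one_left hu.1.le ha1)
    simp only at h
    rw [div_le_div_iff₀ hu.1 hw.1] at h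
    have h1 : 0 < 1 - u ^ 2 := by nlinarith [hu.1, hu.2]
    have h2 : 0 < 1 - (a * u) ^ 2 := by nlinarith [hw.1, hw.2]
    have h3 : (1 - u ^ 2) * logOdds u * a ≤ (1 - (a * u) ^ 2) * logOdds (a * u) :=
      le_of_mul_le_mul_right (by linarith) hu.1
    have : 2 / (1 - (a * u) ^ 2) * a * logOdds u - logOdds (a * u) * (2 / (1 - u ^ 2))
        = 2 * ((1 - u ^ 2) * logOdds u * a - (1 - (a * u) ^ 2) * logOdds (a * u))
          / ((1 - (a * u) ^ 2) * (1 - u ^ 2)) := by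
      rw [eq_div_iff (by positivity)]
      have e1 := h1.ne'
      have e2 := h2.ne'
      generalize 1 - u ^ 2 = x at *
      generalize 1 - (a * u) ^ 2 = y at *
      field_simp
    rw [this]
    apply div_nonpos_of_nonpos_of_nonneg _ (by positivity)
    linarith

lemma logOdds_mono {u v : ℝ} (h0 : 0 ≤ u) (huv : u ≤ v) (h1 : v < 1) : logOdds u ≤ logOdds v :=
  sub_le_sub (Real.log_le_log (by linarith) (by linarith))
    (Real.log_le_log (by linarith) (by linarith))

lemma noiseParam_one_sub_left (r τ : ℝ) : noiseParam (1 - r) τ = 1 - noiseParam r τ := by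
  unfold noiseParam; ring

lemma noiseParam_one_sub_right (r τ : ℝ) : noiseParam r (1 - τ) = 1 - noiseParam r τ := by
  unfold noiseParam; ring

lemma noiseParam_comm (r τ : ℝ) : noiseParam r τ = noiseParam τ r := by
  unfold noiseParam; ring

lemma noiseParam_mem_Ioo {r τ : ℝ} (hr : r ∈ Set.Icc (0 : ℝ) 1) (hτ : τ ∈ Set.Ioo (0 : ℝ) 1) :
    noiseParam r τ ∈ Set.Ioo (0 : ℝ) 1 := by
  obtain ⟨a, b⟩ := hr; obtain ⟨c, d⟩ := hτ
  have e1 : noiseParam r τ = r * (1 - τ) + (1 - r) * τ := by unfold noiseParam; ring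
  have e2 : 1 - noiseParam r τ = (1 - r) * (1 - τ) + r * τ := by unfold noiseParam; ring
  rcases a.eq_or_lt with rfl | a'
  · simp [noiseParam, c, d]
  have h1 : 0 < r * (1 - τ) := mul_pos a' (by linarith)
  have h2 : 0 < r * τ := mul_pos a' c
  have h3 : 0 ≤ (1 - r) * τ := mul_nonneg (by linarith) c.le
  have h4 : 0 ≤ (1 - r) * (1 - τ) := mul_nonneg (by linarith) (by linarith)
  constructor <;> linarith

/-- Noise does not decrease the entropy of a bit. -/
lemma binEntropy_le_noiseParam {r τ : ℝ} (hr : r ∈ Set.Icc (0 : ℝ) 1)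
    (hτ : τ ∈ Set.Icc (0 : ℝ) 1) : Real.binEntropy r ≤ Real.binEntropy (noiseParam r τ) := by
  have hc := Real.strictConcave_binEntropy.concaveOn.2 hr
    (show 1 - r ∈ Set.Icc (0 : ℝ) 1 from ⟨by linarith [hr.2], by linarith [hr.1]⟩)
    (sub_nonneg.2 hτ.2) hτ.1 (by ring)
  simp only [smul_eq_mul, Real.binEntropy_one_sub] at hc
  have : (1 - τ) * r + τ * (1 - r) = noiseParam r τ := by unfold noiseParam; ring
  rw [this] at hc
  linarith

lemma hasDerivAt_binEntropy_logOdds {r : ℝ} (h0 : 0 < r) (h1 : r < 1) :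
    HasDerivAt Real.binEntropy (logOdds (1 - 2 * r)) r := by
  refine (Real.hasDerivAt_binEntropy h0.ne' h1.ne).congr_deriv ?_
  unfold logOdds
  rw [show 1 + (1 - 2 * r) = 2 * (1 - r) by ring, show 1 - (1 - 2 * r) = 2 * r by ring,
    Real.log_mul (by norm_num) (by linarith), Real.log_mul (by norm_num) h0.ne']
  ring

/-- The slope of the tangent at an interior point is the ratio of the two derivatives, and the
difference of the two sides is minimal at `p` since this ratio is monotone. -/
lemma noise_slope_interior {p τ : ℝ} (hp0 : 0 < p) (hp1 : p < 1 / 2) (hτ0 : 0 < τ)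
    (hτ1 : τ < 1 / 2) : ∃ s : ℝ, 0 ≤ s ∧ s ≤ 1 ∧ ∀ r, 0 ≤ r → r ≤ 1 / 2 →
      Real.binEntropy (noiseParam p τ) + s * (Real.binEntropy r - Real.binEntropy p)
        ≤ Real.binEntropy (noiseParam r τ) := by
  set a : ℝ := 1 - 2 * τ with ha
  have ha0 : 0 < a := by linarith
  have ha1 : a ≤ 1 := by linarith
  have hu : ∀ r : ℝ, 0 < r → r < 1 / 2 → (1 - 2 * r) ∈ Set.Ioo (0 : ℝ) 1 := fun r h h' =>
    ⟨by linarith, by linarith⟩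
  set g : ℝ → ℝ := fun u => logOdds (a * u) / logOdds u with hg
  set s : ℝ := a * g (1 - 2 * p) with hs
  have hgp : 0 ≤ g (1 - 2 * p) ∧ g (1 - 2 * p) ≤ 1 := by
    have h := hu p hp0 hp1
    have hlt : a * (1 - 2 * p) ≤ 1 - 2 * p := mul_le_of_le_one_left h.1.le ha1
    have hp := logOdds_pos h.1 h.2
    refine ⟨div_nonneg (logOdds_pos (mul_pos ha0 h.1) (hlt.trans_lt h.2)).le hp.le, ?_⟩
    rw [div_le_one hp]
    exact logOdds_mono (mul_pos ha0 h.1).le hlt h.2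
  set φ : ℝ → ℝ := fun r => Real.binEntropy (noiseParam r τ) - s * Real.binEntropy r with hφ
  have hφc : Continuous φ := by unfold φ noiseParam; fun_prop
  have hd : ∀ r, 0 < r → r < 1 / 2 →
      HasDerivAt φ (a * logOdds (1 - 2 * r) * (g (1 - 2 * r) - g (1 - 2 * p))) r := by
    intro r h h'
    have hn := noiseParam_mem_Ioo (r := r) (τ := τ) ⟨h.le, by linarith⟩ ⟨hτ0, by linarith⟩
    have h1 : HasDerivAt (fun r => noiseParam r τ) a r := by
      have := ((hasDerivAt_id r).add_const τ).sub (((hasDerivAt_id r).const_mul 2).mul_const τ)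
      refine this.congr_deriv ?_
      rw [ha]; ring
    have h2 := ((hasDerivAt_binEntropy_logOdds hn.1 hn.2).comp r h1).sub
      ((hasDerivAt_binEntropy_logOdds h (by linarith)).const_mul s)
    refine h2.congr_deriv ?_
    have e : 1 - 2 * noiseParam r τ = a * (1 - 2 * r) := by unfold noiseParam; rw [ha]; ring
    have hl := (logOdds_pos (hu r h h').1 (hu r h h').2).ne'
    rw [e, hs, mul_sub]
    have : logOdds (1 - 2 * r) * g (1 - 2 * r) = logOdds (a * (1 - 2 * r)) := by
      rw [hg]; field_simp
    linear_combination (-a) * this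
  have key : ∀ r, 0 ≤ r → r ≤ 1 / 2 → φ p ≤ φ r := by
    intro r h h'
    rcases le_total r p with hrp | hrp
    · have hanti : AntitoneOn φ (Set.Icc 0 p) := by
        apply antitoneOn_of_deriv_nonpos (convex_Icc 0 p) hφc.continuousOn
        · rw [interior_Icc]
          exact fun x hx => (hd x hx.1 (hx.2.trans hp1)).differentiableAt.differentiableWithinAt
        · rw [interior_Icc]
          intro x hx
          rw [(hd x hx.1 (hx.2.trans hp1)).deriv]
          have hx' := hu x hx.1 (hx.2.trans hp1)
          refine mul_nonpos_of_nonneg_of_nonpos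
            (mul_nonneg ha0.le (logOdds_pos hx'.1 hx'.2).le) (sub_nonpos.2 ?_)
          exact antitoneOn_logOdds_div ha0 ha1 (hu p hp0 hp1) hx' (by linarith [hx.2])
      exact hanti ⟨h, hrp⟩ ⟨hp0.le, le_rfl⟩ hrp
    · have hmono : MonotoneOn φ (Set.Icc p (1 / 2)) := by
        apply monotoneOn_of_deriv_nonneg (convex_Icc p (1 / 2)) hφc.continuousOn
        · rw [interior_Icc]
          exact fun x hx => (hd x (hp0.trans hx.1) hx.2).differentiableAt.differentiableWithinAt
        · rw [interior_Icc]
          intro x hx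
          rw [(hd x (hp0.trans hx.1) hx.2).deriv]
          have hx' := hu x (hp0.trans hx.1) hx.2
          refine mul_nonneg
            (mul_nonneg ha0.le (logOdds_pos hx'.1 hx'.2).le) (sub_nonneg.2 ?_)
          exact antitoneOn_logOdds_div ha0 ha1 hx' (hu p hp0 hp1) (by linarith [hx.1])
      exact hmono ⟨le_rfl, hp1.le⟩ ⟨hrp, h'⟩ hrp
  refine ⟨s, mul_nonneg ha0.le hgp.1, mul_le_one₀ ha1 hgp.1 hgp.2, fun r h h' => ?_⟩
  have := key r h h'
  simp only [hφ] at this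
  linarith

/-- Mrs. Gerber's lemma for one bit, in tangent form: the graph of the entropy of a noisy bit as a
function of the entropy of the bit lies above a line through the point given by `p`, of slope
`s ∈ [0, 1]`. -/
lemma exists_noise_slope {p τ : ℝ} (hp0 : 0 ≤ p) (hp1 : p ≤ 1 / 2) (hτ0 : 0 < τ) (hτ1 : τ < 1) :
    ∃ s : ℝ, 0 ≤ s ∧ s ≤ 1 ∧ ∀ r ∈ Set.Icc (0 : ℝ) 1,
      Real.binEntropy (noiseParam p τ) + s * (Real.binEntropy r - Real.binEntropy p)
        ≤ Real.binEntropy (noiseParam r τ) := by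
  have hτ : τ ∈ Set.Icc (0 : ℝ) 1 := ⟨hτ0.le, hτ1.le⟩
  -- at `p = 0` the horizontal line will do, and at `p = 1 / 2` the line of slope `1`
  rcases hp0.eq_or_lt with rfl | hp0
  · refine ⟨0, le_rfl, zero_le_one, fun r hr => ?_⟩
    have := binEntropy_le_noiseParam hτ hr
    rw [noiseParam_comm] at this
    simpa [noiseParam] using this
  rcases hp1.eq_or_lt with rfl | hp1
  · refine ⟨1, zero_le_one, le_rfl, fun r hr => ?_⟩
    have := binEntropy_le_noiseParam hr hτ
    have e : noiseParam (1 / 2) τ = 1 / 2 := by unfold noiseParam; ring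
    rw [e]
    linarith
  -- it suffices to treat `r ≤ 1 / 2`, and then `τ ≤ 1 / 2`
  suffices H : ∃ s : ℝ, 0 ≤ s ∧ s ≤ 1 ∧ ∀ r, 0 ≤ r → r ≤ 1 / 2 →
      Real.binEntropy (noiseParam p τ) + s * (Real.binEntropy r - Real.binEntropy p)
        ≤ Real.binEntropy (noiseParam r τ) by
    obtain ⟨s, h0, h1, h⟩ := H
    refine ⟨s, h0, h1, fun r hr => ?_⟩
    rcases le_total r (1 / 2) with h' | h'
    · exact h r hr.1 h'
    · have := h (1 - r) (by linarith [hr.2]) (by linarith)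
      rwa [noiseParam_one_sub_left, Real.binEntropy_one_sub, Real.binEntropy_one_sub] at this
  rcases lt_trichotomy τ (1 / 2) with h | rfl | h
  · exact noise_slope_interior hp0 hp1 hτ0 h
  · refine ⟨0, le_rfl, zero_le_one, fun r _ _ => ?_⟩
    have e : ∀ r : ℝ, noiseParam r (1 / 2) = 1 / 2 := fun r => by unfold noiseParam; ring
    rw [e, e, zero_mul, add_zero]
  · obtain ⟨s, h0, h1, H⟩ := noise_slope_interior (τ := 1 - τ) hp0 hp1 (by linarith) (by linarith)
    refine ⟨s, h0, h1, fun r h h' => ?_⟩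
    have := H r h h'
    simpa only [noiseParam_one_sub_right, Real.binEntropy_one_sub] using this

/-! ### The entropy of a noisy string -/

/-- The probability that a bit `a` becomes `b` when it is changed with probability `τ`. -/
def bitNoise (τ : ℝ) (a b : Bool) : ℝ := if b = a then 1 - τ else τ

lemma bitNoise_nonneg {τ : ℝ} (h0 : 0 ≤ τ) (h1 : τ ≤ 1) (a b : Bool) : 0 ≤ bitNoise τ a b := by
  unfold bitNoise; split_ifs <;> linarith

lemma sum_bitNoise (τ : ℝ) (a : Bool) : ∑ b, bitNoise τ a b = 1 := by
  cases a <;> simp [bitNoise]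

lemma sum_cube_succ {n : ℕ} (f : (Fin (n + 1) → Bool) → ℝ) :
    ∑ y, f y = ∑ b : Bool, ∑ y : Fin n → Bool, f (Fin.cons b y) := by
  rw [← (Fin.consEquiv (fun _ : Fin (n + 1) => Bool)).sum_comp, Fintype.sum_prod_type]
  rfl

lemma noiseWeight_eq_prod (τ : ℝ) {n : ℕ} (x y : Fin n → Bool) :
    noiseWeight τ x y = ∏ i, bitNoise τ (x i) (y i) := rfl

lemma noiseWeight_cons (τ : ℝ) {n : ℕ} (a b : Bool) (x y : Fin n → Bool) :
    noiseWeight τ (Fin.cons a x : Fin (n + 1) → Bool) (Fin.cons b y)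
      = bitNoise τ a b * noiseWeight τ x y := by
  simp [noiseWeight_eq_prod, Fin.prod_univ_succ]

lemma noiseWeight_nonneg {τ : ℝ} (h0 : 0 ≤ τ) (h1 : τ ≤ 1) {n : ℕ} (x y : Fin n → Bool) :
    0 ≤ noiseWeight τ x y :=
  Finset.prod_nonneg fun _ _ => bitNoise_nonneg h0 h1 _ _

lemma sum_noiseWeight (τ : ℝ) {n : ℕ} (x : Fin n → Bool) : ∑ y, noiseWeight τ x y = 1 := by
  simp only [noiseWeight_eq_prod]
  rw [← Fintype.prod_sum]
  simp_rw [sum_bitNoise]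
  simp

/-- The distribution of the noisy version of a random string: the image of the measure `P` under
the noise. -/
def noisy (τ : ℝ) {n : ℕ} (P : (Fin n → Bool) → ℝ) (y : Fin n → Bool) : ℝ :=
  ∑ x, P x * noiseWeight τ x y

lemma noisy_nonneg {τ : ℝ} (h0 : 0 ≤ τ) (h1 : τ ≤ 1) {n : ℕ} {P : (Fin n → Bool) → ℝ}
    (hP : ∀ x, 0 ≤ P x) (y : Fin n → Bool) : 0 ≤ noisy τ P y :=
  Finset.sum_nonneg fun x _ => mul_nonneg (hP x) (noiseWeight_nonneg h0 h1 x y)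

lemma sum_noisy (τ : ℝ) {n : ℕ} (P : (Fin n → Bool) → ℝ) : ∑ y, noisy τ P y = ∑ x, P x := by
  unfold noisy
  rw [Finset.sum_comm]
  simp_rw [← Finset.mul_sum, sum_noiseWeight, mul_one]

lemma noisy_cons (τ : ℝ) {n : ℕ} (P : (Fin (n + 1) → Bool) → ℝ) (b : Bool) (y : Fin n → Bool) :
    noisy τ P (Fin.cons b y)
      = ∑ a, bitNoise τ a b * noisy τ (fun x => P (Fin.cons a x)) y := by
  unfold noisy
  rw [sum_cube_succ]
  refine Finset.sum_congr rfl fun a _ => ?_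
  rw [Finset.mul_sum]
  refine Finset.sum_congr rfl fun x _ => ?_
  rw [noiseWeight_cons]
  ring

/-- The Shannon entropy (in nats) of a finite measure, scaled by its total mass: if `M` has mass
`m`, this is `m` times the entropy of the probability measure `M / m`. With this normalisation
entropy is homogeneous of degree one, and so conditional entropies are sums. -/
def massEntropy {ι : Type*} [Fintype ι] (M : ι → ℝ) : ℝ :=
  ∑ y, Real.negMulLog (M y) - Real.negMulLog (∑ y, M y)

lemma massEntropy_smul {ι : Type*} [Fintype ι] (c : ℝ) (M : ι → ℝ) :
    massEntropy (fun y => c * M y) = c * massEntropy M := by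
  unfold massEntropy
  simp only [← Finset.mul_sum, Real.negMulLog_mul, Finset.sum_add_distrib, ← Finset.sum_mul]
  ring

lemma massEntropy_eq_sum {ι : Type*} [Fintype ι] (M : ι → ℝ) :
    massEntropy M = ∑ y, (Real.negMulLog (M y) + M y * Real.log (∑ z, M z)) := by
  unfold massEntropy
  rw [Finset.sum_add_distrib, ← Finset.sum_mul]
  simp only [Real.negMulLog]
  ring

/-- The log-sum inequality for two summands. -/
lemma negMulLog_add_mul_log_le {a b S T : ℝ} (ha : 0 ≤ a) (hb : 0 ≤ b) (haS : a ≤ S)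
    (hbT : b ≤ T) :
    (Real.negMulLog a + a * Real.log S) + (Real.negMulLog b + b * Real.log T)
      ≤ Real.negMulLog (a + b) + (a + b) * Real.log (S + T) := by
  rcases ha.eq_or_lt with rfl | ha
  · rcases hb.eq_or_lt with rfl | hb
    · simp
    · have := mul_le_mul_of_nonneg_left
        (Real.log_le_log (hb.trans_le hbT) (show T ≤ S + T by linarith)) hb.le
      simpa using this
  rcases hb.eq_or_lt with rfl | hb
  · have := mul_le_mul_of_nonneg_left
      (Real.log_le_log (ha.trans_le haS) (show S ≤ S + T by linarith)) ha.le
    simpa using this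
  have hS := ha.trans_le haS
  have hT := hb.trans_le hbT
  have key : ∀ {u U : ℝ}, 0 < u → 0 < U →
      u * (Real.log U - Real.log u + Real.log (a + b) - Real.log (S + T))
        ≤ U * (a + b) / (S + T) - u := by
    intro u U hu hU
    have e : Real.log U - Real.log u + Real.log (a + b) - Real.log (S + T)
        = Real.log (U * (a + b) / (u * (S + T))) := by
      rw [Real.log_div (by positivity) (by positivity), Real.log_mul (by positivity)
        (by positivity), Real.log_mul (by positivity) (by positivity)]
      ring
    rw [e]
    refine (mul_le_mul_of_nonneg_left
      (Real.log_le_sub_one_of_pos (by positivity)) hu.le).trans_eq ?_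
    field_simp
  have k1 := key ha hS
  have k2 := key hb hT
  have e : S * (a + b) / (S + T) - a + (T * (a + b) / (S + T) - b) = 0 := by
    field_simp
    ring
  simp only [Real.negMulLog]
  nlinarith [k1, k2, e]

lemma massEntropy_add_le {ι : Type*} [Fintype ι] {A B : ι → ℝ} (hA : ∀ y, 0 ≤ A y)
    (hB : ∀ y, 0 ≤ B y) :
    massEntropy A + massEntropy B ≤ massEntropy (fun y => A y + B y) := by
  simp only [massEntropy_eq_sum]
  rw [← Finset.sum_add_distrib]
  refine Finset.sum_le_sum fun y _ => ?_
  rw [Finset.sum_add_distrib]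
  exact negMulLog_add_mul_log_le (hA y) (hB y)
    (Finset.single_le_sum (fun z _ => hA z) (Finset.mem_univ y))
    (Finset.single_le_sum (fun z _ => hB z) (Finset.mem_univ y))

/-- The chain rule for entropy, splitting off the first coordinate. -/
lemma massEntropy_cons {n : ℕ} (M : (Fin (n + 1) → Bool) → ℝ) :
    massEntropy M = massEntropy (fun b : Bool => ∑ y : Fin n → Bool, M (Fin.cons b y))
      + ∑ b : Bool, massEntropy (fun y : Fin n → Bool => M (Fin.cons b y)) := by
  unfold massEntropy
  rw [sum_cube_succ, sum_cube_succ, Finset.sum_sub_distrib]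
  ring

lemma massEntropy_bool {m r : ℝ} :
    massEntropy (fun b : Bool => if b then m * r else m * (1 - r)) = m * Real.binEntropy r := by
  have h : (fun b : Bool => if b then m * r else m * (1 - r))
      = fun b : Bool => m * (if b then r else 1 - r) := by
    funext b; cases b <;> simp
  rw [h, massEntropy_smul]
  simp [massEntropy, Real.binEntropy_eq_negMulLog_add_negMulLog_one_sub]

lemma massEntropy_bitNoise_le {τ s κ : ℝ}
    (hs : ∀ r ∈ Set.Icc (0 : ℝ) 1,
      s * Real.binEntropy r + κ ≤ Real.binEntropy (noiseParam r τ))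
    {Q : Bool → ℝ} (hQ : ∀ b, 0 ≤ Q b) :
    s * massEntropy Q + κ * ∑ b, Q b ≤ massEntropy (fun b => ∑ a, bitNoise τ a b * Q a) := by
  set m := Q true + Q false with hm
  have h1 := hQ true
  have h2 := hQ false
  have hm0 : 0 ≤ m := by linarith
  obtain ⟨r, hr, hr1, hr2⟩ : ∃ r ∈ Set.Icc (0 : ℝ) 1, Q true = m * r ∧ Q false = m * (1 - r) := by
    rcases hm0.eq_or_lt with h | h
    · exact ⟨0, by simp, by nlinarith, by nlinarith⟩
    · refine ⟨Q true / m, ⟨by positivity, (div_le_one h).2 (by linarith)⟩, ?_, ?_⟩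
      · field_simp
      · field_simp; linarith
  have e1 : Q = fun b : Bool => if b then m * r else m * (1 - r) := by
    funext b; cases b <;> simp [hr1, hr2]
  have e2 : (fun b => ∑ a, bitNoise τ a b * Q a)
      = fun b : Bool => if b then m * noiseParam r τ else m * (1 - noiseParam r τ) := by
    funext b
    cases b <;> simp [hr1, hr2, bitNoise, noiseParam] <;> ring
  have e3 : ∑ b, Q b = m := by simp [hm]
  rw [e2, massEntropy_bool, e3, e1, massEntropy_bool]
  nlinarith [mul_le_mul_of_nonneg_left (hs r hr) hm0]

/-- Mrs. Gerber's lemma in tangent form for strings: an affine lower bound for the entropy of a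
noisy bit tensorizes. -/
theorem le_massEntropy_noisy {τ s κ : ℝ} (hτ0 : 0 ≤ τ) (hτ1 : τ ≤ 1)
    (hs : ∀ r ∈ Set.Icc (0 : ℝ) 1,
      s * Real.binEntropy r + κ ≤ Real.binEntropy (noiseParam r τ)) :
    ∀ {n : ℕ} {P : (Fin n → Bool) → ℝ}, (∀ x, 0 ≤ P x) →
      s * massEntropy P + n * κ * ∑ x, P x ≤ massEntropy (noisy τ P) := by
  intro n
  induction n with
  | zero => intro P _; simp [massEntropy]
  | succ n ih =>
    intro P hP
    have hP' : ∀ a x, 0 ≤ (fun x : Fin n → Bool => P (Fin.cons a x)) x := fun a x => hP _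
    rw [massEntropy_cons P, massEntropy_cons (noisy τ P)]
    have first : (fun b : Bool => ∑ y : Fin n → Bool, noisy τ P (Fin.cons b y))
        = fun b => ∑ a, bitNoise τ a b * ∑ x : Fin n → Bool, P (Fin.cons a x) := by
      funext b
      simp_rw [noisy_cons]
      rw [Finset.sum_comm]
      simp_rw [← Finset.mul_sum, sum_noisy]
    have h1 := massEntropy_bitNoise_le hs (Q := fun a => ∑ x : Fin n → Bool, P (Fin.cons a x))
      (fun a => Finset.sum_nonneg fun x _ => hP _)
    rw [first]
    -- conditioning on the input bit rather than on the noisy one only decreases the entropy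
    have h2 : ∑ a, massEntropy (noisy τ (fun x : Fin n → Bool => P (Fin.cons a x)))
        ≤ ∑ b, massEntropy (fun y : Fin n → Bool => noisy τ P (Fin.cons b y)) := by
      calc ∑ a, massEntropy (noisy τ (fun x : Fin n → Bool => P (Fin.cons a x)))
          = ∑ a, ∑ b, bitNoise τ a b
              * massEntropy (noisy τ (fun x : Fin n → Bool => P (Fin.cons a x))) := by
            simp_rw [← Finset.sum_mul, sum_bitNoise, one_mul]
        _ = ∑ b, ∑ a, massEntropy (fun y => bitNoise τ a b
              * noisy τ (fun x : Fin n → Bool => P (Fin.cons a x)) y) := by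
            rw [Finset.sum_comm]
            simp_rw [massEntropy_smul]
        _ ≤ _ := by
            refine Finset.sum_le_sum fun b _ => ?_
            simp_rw [noisy_cons, Fintype.sum_bool]
            exact massEntropy_add_le
              (fun y => mul_nonneg (bitNoise_nonneg hτ0 hτ1 _ _)
                (noisy_nonneg hτ0 hτ1 (hP' _) y))
              (fun y => mul_nonneg (bitNoise_nonneg hτ0 hτ1 _ _)
                (noisy_nonneg hτ0 hτ1 (hP' _) y))
    have h3 := Finset.sum_le_sum fun a (_ : a ∈ Finset.univ) => ih (hP' a)
    rw [Finset.sum_add_distrib, ← Finset.mul_sum, ← Finset.mul_sum] at h3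
    rw [sum_cube_succ P]
    push_cast
    linarith

/-- The entropy of a uniform measure on `B`. -/
lemma massEntropy_uniform {ι : Type*} [Fintype ι] [DecidableEq ι] {B : Finset ι}
    (hB : B.Nonempty) :
    massEntropy (fun x => if x ∈ B then (1 : ℝ) / B.card else 0) = Real.log B.card := by
  have hc : (B.card : ℝ) ≠ 0 := by exact_mod_cast hB.card_pos.ne'
  have h1 : ∑ x, (if x ∈ B then (1 : ℝ) / B.card else 0) = 1 := by
    simp [Finset.sum_ite_mem, hc]
  have h2 : ∀ x, Real.negMulLog (if x ∈ B then (1 : ℝ) / B.card else 0)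
      = if x ∈ B then Real.negMulLog ((1 : ℝ) / B.card) else 0 := by
    intro x; split_ifs <;> simp
  unfold massEntropy
  rw [h1, Finset.sum_congr rfl fun x _ => h2 x, Finset.sum_ite_mem, Finset.univ_inter,
    Finset.sum_const, nsmul_eq_mul, Real.negMulLog_one, sub_zero, Real.negMulLog, one_div,
    Real.log_inv]
  field_simp

lemma negMulLog_le_one (t : ℝ) (ht : 0 ≤ t) : Real.negMulLog t ≤ 1 := by
  have := Real.negMulLog_le_one_sub_self ht
  linarith

/-- Jensen's inequality: the part of an entropy that comes from a set `S`. -/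
lemma sum_negMulLog_le {ι : Type*} {Q : ι → ℝ} (S : Finset ι) (hS : S.Nonempty)
    (hQ : ∀ y ∈ S, 0 ≤ Q y) :
    ∑ y ∈ S, Real.negMulLog (Q y) ≤ (∑ y ∈ S, Q y) * Real.log S.card + 1 := by
  have hc : (0 : ℝ) < S.card := by exact_mod_cast hS.card_pos
  have hj := Real.concaveOn_negMulLog.le_map_sum (t := S) (w := fun _ => (1 : ℝ) / S.card) (p := Q)
    (fun _ _ => by positivity) (by simp [hc.ne']) (fun y hy => hQ y hy)
  simp only [smul_eq_mul, ← Finset.mul_sum] at hj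
  rw [Real.negMulLog_mul] at hj
  have h0 : 0 ≤ ∑ y ∈ S, Q y := Finset.sum_nonneg hQ
  have h1 := negMulLog_le_one _ h0
  have e : Real.negMulLog ((1 : ℝ) / S.card) = 1 / S.card * Real.log S.card := by
    simp [Real.negMulLog]
  rw [e] at hj
  have hj' : 1 / (S.card : ℝ) * ∑ y ∈ S, Real.negMulLog (Q y) ≤ 1 / (S.card : ℝ) *
      ((∑ y ∈ S, Q y) * Real.log S.card + Real.negMulLog (∑ y ∈ S, Q y)) := by linarith
  have := le_of_mul_le_mul_left hj' (by positivity)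
  linarith

/-- A distribution that is concentrated on `S` up to `1 / n` has entropy at most `log |S| + O(1)`. -/
lemma massEntropy_le_of_concentrated {n : ℕ} {Q : (Fin n → Bool) → ℝ} (hQ : ∀ y, 0 ≤ Q y)
    (hQ1 : ∑ y, Q y = 1) {S : Finset (Fin n → Bool)} (hS : S.Nonempty)
    (hc : n * ∑ y ∈ Sᶜ, Q y ≤ 1) :
    massEntropy Q ≤ Real.log S.card + 3 := by
  unfold massEntropy
  rw [hQ1, Real.negMulLog_one, sub_zero, ← Finset.sum_add_sum_compl S]
  have h1 := sum_negMulLog_le S hS (fun y _ => hQ y)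
  have hs : ∑ y ∈ S, Q y ≤ 1 := by
    rw [← hQ1, ← Finset.sum_add_sum_compl S]
    linarith [Finset.sum_nonneg (fun y (_ : y ∈ Sᶜ) => hQ y)]
  have hl : 0 ≤ Real.log S.card := Real.log_natCast_nonneg _
  have h2 : ∑ y ∈ Sᶜ, Real.negMulLog (Q y) ≤ 2 := by
    rcases Sᶜ.eq_empty_or_nonempty with h | h
    · rw [h]; simp
    have h3 := sum_negMulLog_le Sᶜ h (fun y _ => hQ y)
    have h4 : Real.log (Sᶜ.card : ℝ) ≤ n := by
      have hcard : ((Sᶜ.card : ℕ) : ℝ) ≤ 2 ^ n := by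
        have := Finset.card_le_univ Sᶜ
        simp only [Fintype.card_fun, Fintype.card_bool, Fintype.card_fin] at this
        exact_mod_cast this
      refine (Real.log_le_log (by exact_mod_cast h.card_pos) hcard).trans ?_
      rw [Real.log_pow]
      have := Real.log_two_lt_d9
      nlinarith [Nat.cast_nonneg (α := ℝ) n]
    have := mul_le_mul_of_nonneg_left h4
      (Finset.sum_nonneg (fun y (_ : y ∈ Sᶜ) => hQ y))
    linarith
  nlinarith

/-! ### Concentration of measure on the cube -/

lemma noiseProb_eq_sum_filter (τ : ℝ) {n : ℕ} (x : Fin n → Bool) (A : Finset (Fin n → Bool)) :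
    noiseProb τ x (A : Set (Fin n → Bool)) = ∑ y ∈ A, noiseWeight τ x y := by
  unfold noiseProb
  rw [Finset.sum_indicator_eq_sum_filter]
  simp

/-- The one-bit case of the concentration inequality: the values `X₀` and `X₁` of the function are
within a factor `e ^ l` of each other. -/
lemma mul_expectation_inv_le {w₀ w₁ X₀ X₁ l : ℝ} (h₀ : 0 ≤ w₀) (h₁ : 0 ≤ w₁) (hw : w₀ + w₁ = 1)
    (hX₀ : 0 < X₀) (hX₁ : 0 < X₁) (h : X₀ ≤ Real.exp l * X₁) (h' : X₁ ≤ Real.exp l * X₀) :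
    (w₀ * X₀ + w₁ * X₁) * (w₀ * X₀⁻¹ + w₁ * X₁⁻¹) ≤ Real.cosh l := by
  set t := X₀ / X₁ with ht
  have ht0 : 0 < t := by positivity
  have ht1 : t ≤ Real.exp l := by rw [ht, div_le_iff₀ hX₁]; exact h
  have ht2 : t⁻¹ ≤ Real.exp l := by rw [ht, inv_div, div_le_iff₀ hX₀]; exact h'
  have e : (w₀ * X₀ + w₁ * X₁) * (w₀ * X₀⁻¹ + w₁ * X₁⁻¹)
      = w₀ ^ 2 + w₁ ^ 2 + w₀ * w₁ * (t + t⁻¹) := by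
    rw [ht]; field_simp; ring
  have hsum : t + t⁻¹ ≤ 2 * Real.cosh l := by
    have hc : 2 * Real.cosh l = Real.exp l + (Real.exp l)⁻¹ := by
      rw [Real.cosh_eq, Real.exp_neg]; ring
    rw [hc]
    have hE := Real.exp_pos l
    have ht3 : (Real.exp l)⁻¹ ≤ t := inv_le_of_inv_le₀ ht0 ht2
    have : (Real.exp l - t) * (t - (Real.exp l)⁻¹) / t ≥ 0 :=
      div_nonneg (mul_nonneg (by linarith) (by linarith)) ht0.le
    have e2 : (Real.exp l - t) * (t - (Real.exp l)⁻¹) / t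
        = Real.exp l + (Real.exp l)⁻¹ - (t + t⁻¹) := by
      field_simp; ring
    linarith
  have h1 := Real.one_le_cosh l
  have hp : 0 ≤ w₀ * w₁ := mul_nonneg h₀ h₁
  have := mul_le_mul_of_nonneg_left hsum hp
  rw [e]
  have hsq : w₀ ^ 2 + w₁ ^ 2 + 2 * (w₀ * w₁) = 1 := by
    have : (w₀ + w₁) ^ 2 = 1 := by rw [hw]; norm_num
    linarith [this, add_sq w₀ w₁]
  nlinarith

/-- Concentration of measure on the cube: if the positive function `F` changes by a factor of at
most `e ^ l` when a single bit is changed, then `E F · E (1 / F) ≤ (cosh l) ^ n`. -/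
theorem expectation_mul_expectation_inv_le {τ l : ℝ} (hτ0 : 0 ≤ τ) (hτ1 : τ ≤ 1) :
    ∀ {n : ℕ} (x : Fin n → Bool) (F : (Fin n → Bool) → ℝ), (∀ y, 0 < F y) →
      (∀ y i b, F (Function.update y i b) ≤ Real.exp l * F y) →
      (∑ y, noiseWeight τ x y * F y) * (∑ y, noiseWeight τ x y * (F y)⁻¹) ≤ Real.cosh l ^ n := by
  intro n
  induction n with
  | zero =>
    intro x F hF _
    simp [noiseWeight, (hF _).ne']
  | succ n ih =>
    intro x F hF hl
    obtain ⟨a, x, rfl⟩ : ∃ a x', x = (Fin.cons a x' : Fin (n + 1) → Bool) :=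
      ⟨x 0, Fin.tail x, (Fin.cons_self_tail x).symm⟩
    set X : Bool → ℝ := fun b => ∑ y, noiseWeight τ x y * F (Fin.cons b y) with hX
    set Z : Bool → ℝ := fun b => ∑ y, noiseWeight τ x y * (F (Fin.cons b y))⁻¹ with hZ
    have hXZ : ∀ b, X b * Z b ≤ Real.cosh l ^ n := fun b =>
      ih x (fun y => F (Fin.cons b y)) (fun y => hF _) fun y i c => by
        have := hl (Fin.cons b y) i.succ c
        rwa [← Fin.cons_update] at this
    have hw := noiseWeight_nonneg hτ0 hτ1 x
    have hpos : ∀ b, 0 < X b := by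
      intro b
      have hne : ∑ y, noiseWeight τ x y ≠ 0 := by rw [sum_noiseWeight]; norm_num
      obtain ⟨y, _, hy⟩ := Finset.exists_ne_zero_of_sum_ne_zero hne
      exact Finset.sum_pos' (fun z _ => mul_nonneg (hw z) (hF _).le)
        ⟨y, Finset.mem_univ _, mul_pos ((hw y).lt_of_ne' hy) (hF _)⟩
    have hcmp : ∀ b c, X b ≤ Real.exp l * X c := by
      intro b c
      simp only [hX, Finset.mul_sum]
      refine Finset.sum_le_sum fun y _ => ?_
      have := hl (Fin.cons c y) 0 b
      rw [Fin.update_cons_zero] at this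
      nlinarith [mul_le_mul_of_nonneg_left this (hw y)]
    have hZle : ∀ b, Z b ≤ Real.cosh l ^ n * (X b)⁻¹ := fun b => by
      rw [← div_eq_mul_inv, le_div_iff₀ (hpos b), mul_comm]
      exact hXZ b
    have hb := bitNoise_nonneg hτ0 hτ1 a
    have e1 : ∑ y, noiseWeight τ (Fin.cons a x : Fin (n + 1) → Bool) y * F y
        = bitNoise τ a true * X true + bitNoise τ a false * X false := by
      rw [sum_cube_succ]
      simp only [noiseWeight_cons, Fintype.sum_bool, hX, Finset.mul_sum, mul_assoc]
    have e2 : ∑ y, noiseWeight τ (Fin.cons a x : Fin (n + 1) → Bool) y * (F y)⁻¹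
        = bitNoise τ a true * Z true + bitNoise τ a false * Z false := by
      rw [sum_cube_succ]
      simp only [noiseWeight_cons, Fintype.sum_bool, hZ, Finset.mul_sum, mul_assoc]
    have hsum : bitNoise τ a true + bitNoise τ a false = 1 := by
      rw [← sum_bitNoise τ a, Fintype.sum_bool]
    have hcore := mul_expectation_inv_le (hb true) (hb false) hsum (hpos true) (hpos false)
      (hcmp _ _) (hcmp _ _)
    have hC : 0 ≤ Real.cosh l ^ n := pow_nonneg (Real.cosh_pos l).le n
    rw [e1, e2]
    calc _ ≤ (bitNoise τ a true * X true + bitNoise τ a false * X false)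
            * (bitNoise τ a true * (Real.cosh l ^ n * (X true)⁻¹)
              + bitNoise τ a false * (Real.cosh l ^ n * (X false)⁻¹)) := by
          refine mul_le_mul_of_nonneg_left ?_ (add_nonneg
            (mul_nonneg (hb _) (hpos _).le) (mul_nonneg (hb _) (hpos _).le))
          exact add_le_add (mul_le_mul_of_nonneg_left (hZle _) (hb _))
            (mul_le_mul_of_nonneg_left (hZle _) (hb _))
      _ = Real.cosh l ^ n * ((bitNoise τ a true * X true + bitNoise τ a false * X false)
            * (bitNoise τ a true * (X true)⁻¹ + bitNoise τ a false * (X false)⁻¹)) := by ring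
      _ ≤ Real.cosh l ^ n * Real.cosh l := mul_le_mul_of_nonneg_left hcore hC
      _ = Real.cosh l ^ (n + 1) := (pow_succ _ _).symm

/-- The strings at Hamming distance at most `r` from the set `A`. -/
def hammingNhd {n : ℕ} (A : Finset (Fin n → Bool)) (r : ℕ) : Finset (Fin n → Bool) :=
  Finset.univ.filter fun y => ∃ a ∈ A, hammingDist y a ≤ r

/-- The Hamming distance from a point to a nonempty set. -/
def distTo {n : ℕ} (A : Finset (Fin n → Bool)) (hA : A.Nonempty) (y : Fin n → Bool) : ℕ :=
  A.inf' hA fun a => hammingDist y a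

lemma hammingDist_update_le {n : ℕ} (y : Fin n → Bool) (i : Fin n) (b : Bool) :
    hammingDist (Function.update y i b) y ≤ 1 := by
  unfold hammingDist
  refine (Finset.card_le_card (t := {i}) fun j hj => ?_).trans (by simp)
  simp only [Finset.mem_filter, Finset.mem_univ, true_and] at hj
  by_contra h
  exact hj (Function.update_of_ne (by simpa using h) _ _)

lemma distTo_update_le {n : ℕ} (A : Finset (Fin n → Bool)) (hA : A.Nonempty) (y : Fin n → Bool)
    (i : Fin n) (b : Bool) : distTo A hA (Function.update y i b) ≤ distTo A hA y + 1 := by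
  obtain ⟨a, ha, h⟩ := Finset.exists_mem_eq_inf' hA fun a => hammingDist y a
  have h1 : distTo A hA (Function.update y i b) ≤ hammingDist (Function.update y i b) a :=
    Finset.inf'_le _ ha
  have h2 := hammingDist_triangle (Function.update y i b) y a
  have h3 := hammingDist_update_le y i b
  have h4 : distTo A hA y = hammingDist y a := h
  omega

/-- The blowing-up lemma: a neighbourhood of a set that is not too improbable has probability
close to one. -/
theorem sum_compl_hammingNhd_le {τ : ℝ} (hτ0 : 0 ≤ τ) (hτ1 : τ ≤ 1) {n : ℕ} (hn : 0 < n)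
    (x : Fin n → Bool) (A : Finset (Fin n → Bool)) (r : ℕ) :
    (∑ y ∈ A, noiseWeight τ x y) * ∑ y ∈ (hammingNhd A r)ᶜ, noiseWeight τ x y
      ≤ Real.exp (-(r : ℝ) ^ 2 / (2 * n)) := by
  rcases A.eq_empty_or_nonempty with rfl | hA
  · simp; positivity
  have hw := noiseWeight_nonneg hτ0 hτ1 x
  have hn' : (0 : ℝ) < n := by exact_mod_cast hn
  set l : ℝ := r / n with hl
  have hl0 : 0 ≤ l := by positivity
  have hmain := expectation_mul_expectation_inv_le (l := l) hτ0 hτ1 x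
    (fun y => Real.exp (l * distTo A hA y)) (fun y => Real.exp_pos _) (fun y i b => by
      rw [← Real.exp_add]
      apply Real.exp_le_exp.2
      have : (distTo A hA (Function.update y i b) : ℝ) ≤ distTo A hA y + 1 := by
        exact_mod_cast distTo_update_le A hA y i b
      nlinarith)
  have h1 : ∑ y ∈ A, noiseWeight τ x y
      ≤ ∑ y, noiseWeight τ x y * (Real.exp (l * distTo A hA y))⁻¹ := by
    refine (Finset.sum_le_sum fun y hy => ?_).trans (Finset.sum_le_univ_sum_of_nonneg
      (s := A) fun y => mul_nonneg (hw y) (by positivity))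
    have : distTo A hA y = 0 := by
      have : distTo A hA y ≤ hammingDist y y := Finset.inf'_le _ hy
      simpa using this
    simp [this]
  have h2 : Real.exp (l * r) * ∑ y ∈ (hammingNhd A r)ᶜ, noiseWeight τ x y
      ≤ ∑ y, noiseWeight τ x y * Real.exp (l * distTo A hA y) := by
    rw [Finset.mul_sum]
    refine (Finset.sum_le_sum fun y hy => ?_).trans (Finset.sum_le_univ_sum_of_nonneg
      (s := (hammingNhd A r)ᶜ) fun y => mul_nonneg (hw y) (by positivity))
    rw [mul_comm]
    refine mul_le_mul_of_nonneg_left (Real.exp_le_exp.2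
      (mul_le_mul_of_nonneg_left ?_ hl0)) (hw y)
    norm_cast
    by_contra hlt
    obtain ⟨a, ha, h⟩ := Finset.exists_mem_eq_inf' hA fun a => hammingDist y a
    have h4 : distTo A hA y = hammingDist y a := h
    refine (Finset.mem_compl.1 hy) (Finset.mem_filter.2 ⟨Finset.mem_univ _, a, ha, ?_⟩)
    omega
  have hA0 : 0 ≤ ∑ y ∈ A, noiseWeight τ x y := Finset.sum_nonneg fun y _ => hw y
  have h3 : (Real.exp (l * r) * ∑ y ∈ (hammingNhd A r)ᶜ, noiseWeight τ x y)
      * ∑ y ∈ A, noiseWeight τ x y ≤ Real.cosh l ^ n :=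
    (mul_le_mul h2 h1 hA0 (Finset.sum_nonneg fun y _ => mul_nonneg (hw y) (by positivity))).trans
      hmain
  have h4 : Real.cosh l ^ n ≤ Real.exp (n * (l ^ 2 / 2)) := by
    rw [Real.exp_nat_mul]
    exact pow_le_pow_left₀ (Real.cosh_pos l).le (Real.cosh_le_exp_half_sq l) n
  have e : Real.exp (-(r : ℝ) ^ 2 / (2 * n)) = Real.exp (-(l * r)) * Real.exp (n * (l ^ 2 / 2)) := by
    rw [← Real.exp_add, hl]
    congr 1
    field_simp
    ring
  rw [e]
  have h5 := mul_le_mul_of_nonneg_left (h3.trans h4) (Real.exp_pos (-(l * r))).le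
  refine le_trans (le_of_eq ?_) h5
  have : Real.exp (-(l * r)) * Real.exp (l * r) = 1 := by rw [← Real.exp_add]; simp
  linear_combination (-(∑ y ∈ A, noiseWeight τ x y)
    * ∑ y ∈ (hammingNhd A r)ᶜ, noiseWeight τ x y) * this

lemma card_hammingNhd_succ_le {n : ℕ} (A : Finset (Fin n → Bool)) (r : ℕ) :
    (hammingNhd A (r + 1)).card ≤ (n + 1) * (hammingNhd A r).card := by
  classical
  -- `none` changes nothing, and `some i` flips the bit `i`
  let g : Option (Fin n) × (Fin n → Bool) → (Fin n → Bool) := fun q =>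
    q.1.elim q.2 fun i => Function.update q.2 i (!q.2 i)
  have hsub : hammingNhd A (r + 1) ⊆ (Finset.univ ×ˢ hammingNhd A r).image g := by
    intro y hy
    obtain ⟨a, ha, hd⟩ := (Finset.mem_filter.1 hy).2
    rw [Finset.mem_image]
    rcases Nat.lt_or_ge r (hammingDist y a) with h | h
    · obtain ⟨i, hi⟩ : ∃ i, y i ≠ a i := by
        by_contra! hc
        rw [hammingDist_eq_zero.2 (funext hc)] at h
        omega
      refine ⟨(some i, Function.update y i (a i)), ?_, ?_⟩
      · refine Finset.mem_product.2 ⟨Finset.mem_univ _, Finset.mem_filter.2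
          ⟨Finset.mem_univ _, a, ha, ?_⟩⟩
        have hlt : hammingDist (Function.update y i (a i)) a < hammingDist y a := by
          unfold hammingDist
          refine Finset.card_lt_card ⟨fun j hj => ?_, fun hs => ?_⟩
          · simp only [Finset.mem_filter, Finset.mem_univ, true_and] at hj ⊢
            rcases eq_or_ne j i with rfl | hne
            · simp at hj
            · rwa [Function.update_of_ne hne] at hj
          · have := hs (Finset.mem_filter.2 ⟨Finset.mem_univ i, hi⟩)
            simp at this
        show hammingDist (Function.update y i (a i)) a ≤ r
        omega
      · simp only [g, Option.elim_some, Function.update_self, Function.update_idem]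
        have : (!a i) = y i := by
          revert hi; cases y i <;> cases a i <;> simp
        rw [this, Function.update_eq_self]
    · exact ⟨(none, y), Finset.mem_product.2 ⟨Finset.mem_univ _, Finset.mem_filter.2
        ⟨Finset.mem_univ _, a, ha, h⟩⟩, rfl⟩
  refine (Finset.card_le_card hsub).trans (Finset.card_image_le.trans ?_)
  simp [Finset.card_product]

lemma card_hammingNhd_le {n : ℕ} (A : Finset (Fin n → Bool)) (r : ℕ) :
    (hammingNhd A r).card ≤ (n + 1) ^ r * A.card := by
  induction r with
  | zero =>
    rw [pow_zero, one_mul]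
    refine Finset.card_le_card fun y hy => ?_
    obtain ⟨a, ha, hd⟩ := (Finset.mem_filter.1 hy).2
    rwa [hammingDist_eq_zero.1 (Nat.le_zero.1 hd)]
  | succ r ih =>
    refine (card_hammingNhd_succ_le A r).trans ?_
    rw [pow_succ', mul_assoc]
    exact Nat.mul_le_mul_left _ ih

/-! ### Descriptions of the elements of an enumerable set -/

/-- The number with binary digits `l`, least significant digit first. -/
def bitVal : List Bool → ℕ
  | [] => 0
  | b :: l => b.toNat + 2 * bitVal l

lemma bitVal_append (l l' : List Bool) :
    bitVal (l ++ l') = bitVal l + 2 ^ l.length * bitVal l' := by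
  induction l with
  | nil => simp [bitVal]
  | cons b l ih => simp only [List.cons_append, bitVal, ih, List.length_cons, pow_succ]; ring

lemma bitVal_lt (l : List Bool) : bitVal l < 2 ^ l.length := by
  induction l with
  | nil => simp [bitVal]
  | cons b l ih =>
    have := Bool.toNat_le b
    simp only [bitVal, List.length_cons, pow_succ]
    omega

lemma exists_bitVal_eq {k j : ℕ} (h : j < 2 ^ k) : ∃ l : List Bool, l.length = k ∧ bitVal l = j := by
  induction k generalizing j with
  | zero => exact ⟨[], rfl, by simp [bitVal] at *; omega⟩
  | succ k ih =>
    obtain ⟨l, hl, hv⟩ := ih (j := j / 2) (by rw [pow_succ] at h; omega)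
    refine ⟨decide (j % 2 = 1) :: l, by simp [hl], ?_⟩
    simp only [bitVal, hv]
    rcases Nat.mod_two_eq_zero_or_one j with h0 | h0 <;> simp [h0] <;> omega

lemma primrec_bitVal : Primrec bitVal := by
  have h : Primrec fun l : List Bool => l.foldr (fun b v => b.toNat + 2 * v) 0 :=
    Primrec.list_foldr Primrec.id (Primrec.const 0)
      (Primrec.nat_add.comp ((Primrec.dom_bool _).comp (Primrec.fst.comp Primrec.snd))
        (Primrec.nat_mul.comp (Primrec.const 2) (Primrec.snd.comp Primrec.snd))).to₂
  refine h.of_eq fun l => ?_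
  induction l with
  | nil => rfl
  | cons b l ih => simp only [List.foldr_cons, bitVal, ih]

/-- A self-delimiting way to read a pair of numbers `(m, j)` from a string `1 ^ a 0 u v`, where `u`
consists of the `a` binary digits of `m`, and `v` of those of `j`. -/
def parsePair (q : List Bool) : ℕ × ℕ :=
  (bitVal q / 2 ^ (q.idxOf false + 1) % 2 ^ q.idxOf false,
    bitVal q / 2 ^ (q.idxOf false + 1) / 2 ^ q.idxOf false)

lemma primrec_two_pow : Primrec fun n : ℕ => 2 ^ n := by
  have h : Primrec fun n : ℕ => Nat.rec (motive := fun _ => ℕ) 1 (fun _ v => 2 * v) n :=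
    Primrec.nat_rec₁ 1 (Primrec.nat_mul.comp (Primrec.const 2) Primrec.snd).to₂
  refine h.of_eq fun n => ?_
  induction n with
  | zero => rfl
  | succ n ih => exact (congrArg (2 * ·) ih).trans (pow_succ' 2 n).symm

lemma primrec_parsePair : Primrec parsePair := by
  have ha : Primrec fun q : List Bool => q.idxOf false :=
    Primrec.list_idxOf.comp (Primrec.const false) Primrec.id
  have hv : Primrec fun q : List Bool => bitVal q / 2 ^ (q.idxOf false + 1) :=
    Primrec.nat_div.comp primrec_bitVal (primrec_two_pow.comp (Primrec.succ.comp ha))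
  exact (Primrec.nat_mod.comp hv (primrec_two_pow.comp ha)).pair
    (Primrec.nat_div.comp hv (primrec_two_pow.comp ha))

lemma exists_parsePair_eq {a k m j : ℕ} (hm : m < 2 ^ a) (hj : j < 2 ^ k) :
    ∃ q : List Bool, q.length = k + 2 * a + 1 ∧ parsePair q = (m, j) := by
  obtain ⟨u, hu, rfl⟩ := exists_bitVal_eq hm
  obtain ⟨v, hv, rfl⟩ := exists_bitVal_eq hj
  refine ⟨(List.replicate a true ++ [false]) ++ (u ++ v), by simp [hu, hv]; omega, ?_⟩
  have hidx : ((List.replicate a true ++ [false]) ++ (u ++ v)).idxOf false = a := by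
    rw [List.append_assoc, List.idxOf_append_of_notMem (by simp)]
    simp
  have hval : bitVal ((List.replicate a true ++ [false]) ++ (u ++ v)) / 2 ^ (a + 1)
      = bitVal u + 2 ^ a * bitVal v := by
    rw [bitVal_append, bitVal_append u v, hu]
    have h := bitVal_lt (List.replicate a true ++ [false])
    simp only [List.length_append, List.length_replicate, List.length_singleton] at h ⊢
    rw [Nat.add_mul_div_left _ _ (by positivity), Nat.div_eq_of_lt h, zero_add]
  unfold parsePair
  rw [hidx, hval, Nat.add_mul_mod_self_left, Nat.mod_eq_of_lt hm,
    Nat.add_mul_div_left _ _ (by positivity), Nat.div_eq_of_lt hm, zero_add]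

/-- The list of strings `x` with `R m x s` for some stage `s`, without repetitions, as found by the
first `e` steps of a search over all pairs `(x, s)`. -/
def enumList (R : ℕ → List Bool → ℕ → Bool) (m : ℕ) : ℕ → List (List Bool)
  | 0 => []
  | e + 1 => (Encodable.decode (α := List Bool × ℕ) e).elim (enumList R m e) fun xs =>
      if R m xs.1 xs.2 = true ∧ xs.1 ∉ enumList R m e then
        enumList R m e ++ [xs.1] else enumList R m e

section enumeration

variable {R : ℕ → List Bool → ℕ → Bool}

lemma primrec_enumList (hR : Primrec fun p : ℕ × List Bool × ℕ => R p.1 p.2.1 p.2.2) :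
    Primrec₂ (enumList R) := by
  have hstep : Primrec₂ fun (m : ℕ) (p : ℕ × List (List Bool)) =>
      (Encodable.decode (α := List Bool × ℕ) p.1).elim p.2 fun xs =>
        if R m xs.1 xs.2 = true ∧ xs.1 ∉ p.2 then p.2 ++ [xs.1] else p.2 := by
    have hL : Primrec fun r : (ℕ × ℕ × List (List Bool)) × List Bool × ℕ => r.1.2.2 :=
      Primrec.snd.comp (Primrec.snd.comp Primrec.fst)
    have hx : Primrec fun r : (ℕ × ℕ × List (List Bool)) × List Bool × ℕ => r.2.1 :=
      Primrec.fst.comp Primrec.snd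
    have hif : Primrec fun r : (ℕ × ℕ × List (List Bool)) × List Bool × ℕ =>
        if R r.1.1 r.2.1 r.2.2 = true ∧ r.2.1 ∉ r.1.2.2 then
          r.1.2.2 ++ [r.2.1] else r.1.2.2 := by
      refine Primrec.ite (PrimrecPred.and ?_ ?_) (Primrec.list_concat.comp hL hx) hL
      · exact Primrec.eq.comp (hR.comp ((Primrec.fst.comp Primrec.fst).pair Primrec.snd))
          (Primrec.const true)
      · have hne : PrimrecRel fun y x : List Bool => y ≠ x := Primrec.eq.not
        exact (hne.forall_mem_list.comp hL hx).of_eq fun r =>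
          ⟨fun h hr => h _ hr rfl, fun h y hy hyx => h (hyx ▸ hy)⟩
    have := Primrec.option_casesOn (o := fun p : ℕ × ℕ × List (List Bool) =>
        Encodable.decode (α := List Bool × ℕ) p.2.1) (f := fun p => p.2.2)
      (g := fun p xs => if R p.1 xs.1 xs.2 = true ∧ xs.1 ∉ p.2.2 then
          p.2.2 ++ [xs.1] else p.2.2)
      (Primrec.decode.comp (Primrec.fst.comp Primrec.snd)) (Primrec.snd.comp Primrec.snd) hif
    refine this.of_eq fun p => ?_
    have hcases : ∀ {β γ : Type} (o : Option β) (u : γ) (v : β → γ),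
        (Option.casesOn o u v : γ) = o.elim u v := fun o u v => by cases o <;> rfl
    exact hcases _ _ _
  refine (Primrec.nat_rec (f := fun _ : ℕ => ([] : List (List Bool)))
    (Primrec.const []) hstep).of_eq fun m e => ?_
  induction e with
  | zero => rfl
  | succ e ih => simp only [enumList] at ih ⊢; rw [← ih]

lemma enumList_succ_eq (m e : ℕ) : enumList R m (e + 1) = enumList R m e ∨
    ∃ x s, Encodable.decode (α := List Bool × ℕ) e = some (x, s) ∧ R m x s = true ∧
      x ∉ enumList R m e ∧ enumList R m (e + 1) = enumList R m e ++ [x] := by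
  rw [enumList]
  rcases h : Encodable.decode (α := List Bool × ℕ) e with _ | ⟨x, s⟩
  · exact Or.inl rfl
  · simp only [Option.elim_some]
    split_ifs with hc
    · exact Or.inr ⟨x, s, rfl, hc.1, hc.2, rfl⟩
    · exact Or.inl rfl

lemma enumList_prefix (m : ℕ) {e e' : ℕ} (h : e ≤ e') : enumList R m e <+: enumList R m e' := by
  induction e', h using Nat.le_induction with
  | base => exact List.prefix_rfl
  | succ e' _ ih =>
    rcases enumList_succ_eq (R := R) m e' with h | ⟨x, s, -, -, -, h⟩
    · rwa [h]
    · rw [h]; exact ih.trans (List.prefix_append _ _)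

lemma enumList_nodup (m e : ℕ) : (enumList R m e).Nodup := by
  induction e with
  | zero => exact List.nodup_nil
  | succ e ih =>
    rcases enumList_succ_eq (R := R) m e with h | ⟨x, s, -, -, hx, h⟩
    · rwa [h]
    · rw [h]
      exact List.nodup_append.2 ⟨ih, List.nodup_singleton _, fun a ha b hb hab =>
        hx ((List.mem_singleton.1 hb) ▸ hab ▸ ha)⟩

lemma enumList_sound {m e : ℕ} {x : List Bool} (hx : x ∈ enumList R m e) :
    ∃ s, R m x s = true := by
  induction e with
  | zero => simp [enumList] at hx
  | succ e ih =>
    rcases enumList_succ_eq (R := R) m e with h | ⟨y, s, -, hR, -, h⟩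
    · exact ih (h ▸ hx)
    · rw [h, List.mem_append, List.mem_singleton] at hx
      rcases hx with hx | rfl
      · exact ih hx
      · exact ⟨s, hR⟩

lemma enumList_complete {m : ℕ} {x : List Bool} {s : ℕ} (h : R m x s = true) :
    ∃ e, x ∈ enumList R m e := by
  refine ⟨Encodable.encode (x, s) + 1, ?_⟩
  rw [enumList, Encodable.encodek]
  simp only [Option.elim_some, h, true_and]
  split_ifs with hc
  · exact hc
  · exact List.mem_append_right _ (List.mem_singleton_self x)

/-- The decompressor that maps a description of `(m, j)` to the `j`-th string in the enumeration
with parameter `m`. -/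
def enumDecompressor (R : ℕ → List Bool → ℕ → Bool) (q : List Bool) : Part (List Bool) :=
  Nat.rfindOpt fun e => (enumList R (parsePair q).1 e)[(parsePair q).2]?

lemma partrec_enumDecompressor
    (hR : Primrec fun p : ℕ × List Bool × ℕ => R p.1 p.2.1 p.2.2) :
    Partrec (enumDecompressor R) := by
  refine Partrec.rfindOpt (Primrec.to_comp ?_)
  have hp : Primrec fun p : List Bool × ℕ => parsePair p.1 := primrec_parsePair.comp Primrec.fst
  exact Primrec.list_getElem?.comp
    ((primrec_enumList hR).comp (Primrec.fst.comp hp) Primrec.snd) (Primrec.snd.comp hp)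

lemma mem_enumDecompressor {q x : List Bool} {e : ℕ}
    (h : (enumList R (parsePair q).1 e)[(parsePair q).2]? = some x) :
    x ∈ enumDecompressor R q := by
  refine (Nat.rfindOpt_mono fun {a i j} hij ha => ?_).2 ⟨e, h⟩
  obtain ⟨t, ht⟩ := enumList_prefix (R := R) (parsePair q).1 hij
  rw [Option.mem_def] at ha ⊢
  rw [← ht, List.getElem?_append_left (List.getElem?_eq_some_iff.1 ha).1]
  exact ha

end enumeration

section complexity

variable {U : List Bool →. List Bool}

lemma plainComplexity_le_of_mem {q x : List Bool} (h : x ∈ U q) :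
    plainComplexity U x ≤ q.length :=
  Nat.sInf_le ⟨q, rfl, h⟩

lemma IsOptimalDecompressor.plainComplexity_le (hU : IsOptimalDecompressor U)
    {V : List Bool →. List Bool} (hV : Partrec V) :
    ∃ c : ℕ, ∀ q x : List Bool, x ∈ V q → plainComplexity U x ≤ q.length + c := by
  obtain ⟨c, hc⟩ := hU.2 V hV
  refine ⟨c, fun q x hx => ?_⟩
  obtain ⟨r, hr, hl⟩ := hc q x hx
  exact (plainComplexity_le_of_mem hr).trans hl

lemma IsOptimalDecompressor.plainComplexity_le_length (hU : IsOptimalDecompressor U) :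
    ∃ c : ℕ, ∀ x : List Bool, plainComplexity U x ≤ x.length + c := by
  obtain ⟨c, hc⟩ := hU.plainComplexity_le (V := fun q => Part.some q) Partrec.some
  exact ⟨c, fun x => hc x x (Part.mem_some x)⟩

lemma IsOptimalDecompressor.exists_program (hU : IsOptimalDecompressor U) (x : List Bool) :
    ∃ q : List Bool, q.length = plainComplexity U x ∧ x ∈ U q := by
  obtain ⟨c, hc⟩ := hU.2 (fun q => Part.some q) Partrec.some
  obtain ⟨r, hr, -⟩ := hc x x (Part.mem_some x)
  exact Nat.sInf_mem (s := {l : ℕ | ∃ q : List Bool, q.length = l ∧ x ∈ U q}) ⟨_, r, rfl, hr⟩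

lemma IsOptimalDecompressor.plainComplexity_lt_iff (hU : IsOptimalDecompressor U)
    (x : List Bool) (K : ℕ) :
    plainComplexity U x < K ↔ ∃ q : List Bool, q.length < K ∧ x ∈ U q := by
  constructor
  · intro h
    obtain ⟨q, hq, hx⟩ := hU.exists_program x
    exact ⟨q, hq ▸ h, hx⟩
  · rintro ⟨q, hq, hx⟩
    exact (plainComplexity_le_of_mem hx).trans_lt hq

/-- A string in an enumerable set of at most `2 ^ k` elements, given by a parameter `m < 2 ^ a`, is
determined by `m` and by its position in the enumeration. -/
theorem IsOptimalDecompressor.plainComplexity_le_of_enumerable (hU : IsOptimalDecompressor U)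
    {R : ℕ → List Bool → ℕ → Bool}
    (hR : Primrec fun p : ℕ × List Bool × ℕ => R p.1 p.2.1 p.2.2) :
    ∃ c : ℕ, ∀ (m a k : ℕ) (S : Finset (List Bool)), (∀ y s, R m y s = true → y ∈ S) →
      S.card ≤ 2 ^ k → m < 2 ^ a → ∀ x s, R m x s = true →
        plainComplexity U x ≤ k + 2 * a + c := by
  obtain ⟨c, hc⟩ := hU.plainComplexity_le (partrec_enumDecompressor hR)
  refine ⟨1 + c, fun m a k S hS hcard hm x s hx => ?_⟩
  obtain ⟨e, he⟩ := enumList_complete hx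
  have hj := List.idxOf_lt_length_iff.2 he
  have hlen : (enumList R m e).length ≤ S.card := by
    rw [← List.toFinset_card_of_nodup (enumList_nodup m e)]
    refine Finset.card_le_card fun y hy => ?_
    obtain ⟨s, hs⟩ := enumList_sound (List.mem_toFinset.1 hy)
    exact hS y s hs
  obtain ⟨q, hql, hq⟩ := exists_parsePair_eq (k := k) hm
    ((hj.trans_le hlen).trans_le hcard)
  have hmem : x ∈ enumDecompressor R q := by
    refine mem_enumDecompressor (e := e) ?_
    rw [hq, List.getElem?_eq_getElem hj, List.getElem_idxOf]
  have := hc q x hmem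
  omega

end complexity

/-! ### The strings that noise makes simple are enumerable -/

section primrec

variable {α : Type*} [Primcodable α]

lemma primrec_sum_range {f : α → ℕ} {g : α → ℕ → ℕ} (hf : Primrec f) (hg : Primrec₂ g) :
    Primrec fun a => ∑ i ∈ Finset.range (f a), g a i := by
  have h := Primrec.nat_rec' (h := fun a (p : ℕ × ℕ) => p.2 + g a p.1) hf (Primrec.const 0)
    (Primrec.nat_add.comp (Primrec.snd.comp Primrec.snd)
      (hg.comp Primrec.fst (Primrec.fst.comp Primrec.snd))).to₂
  refine h.of_eq fun a => ?_
  induction f a with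
  | zero => rfl
  | succ n ih => rw [Finset.sum_range_succ, ← ih]

lemma primrec_prod_range {f : α → ℕ} {g : α → ℕ → ℕ} (hf : Primrec f) (hg : Primrec₂ g) :
    Primrec fun a => ∏ i ∈ Finset.range (f a), g a i := by
  have h := Primrec.nat_rec' (h := fun a (p : ℕ × ℕ) => p.2 * g a p.1) hf (Primrec.const 1)
    (Primrec.nat_mul.comp (Primrec.snd.comp Primrec.snd)
      (hg.comp Primrec.fst (Primrec.fst.comp Primrec.snd))).to₂
  refine h.of_eq fun a => ?_
  induction f a with
  | zero => rfl
  | succ n ih => rw [Finset.prod_range_succ, ← ih]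

lemma primrec_option_elim {β γ : Type*} [Primcodable β] [Primcodable γ] {o : α → Option β}
    {f : α → γ} {g : α → β → γ} (ho : Primrec o) (hf : Primrec f) (hg : Primrec₂ g) :
    Primrec fun a => (o a).elim (f a) (g a) :=
  (Primrec.option_casesOn ho hf hg).of_eq fun a => by cases o a <;> rfl

end primrec

open Nat.Partrec (Code)

/-- The number of programs of length less than `K` for which the machine with code `c` is found to
output `y` within `s` steps. -/
def stageCount (c : Code) (K : ℕ) (y : List Bool) (s : ℕ) : ℕ :=
  ∑ e ∈ Finset.range s, (Encodable.decode₂ (List Bool) e).elim 0 fun q =>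
    if q.length < K ∧ Code.evaln s c e = some (Encodable.encode y) then 1 else 0

lemma primrec_stageCount (c : Code) :
    Primrec fun p : ℕ × List Bool × ℕ => stageCount c p.1 p.2.1 p.2.2 := by
  refine primrec_sum_range (Primrec.snd.comp Primrec.snd) ?_
  refine primrec_option_elim (α := (ℕ × List Bool × ℕ) × ℕ)
    (Primrec.decode₂.comp Primrec.snd) (Primrec.const 0) ?_
  refine Primrec.ite (PrimrecPred.and ?_ ?_) (Primrec.const 1) (Primrec.const 0)
  · exact Primrec.nat_lt.comp (Primrec.list_length.comp Primrec.snd)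
      (Primrec.fst.comp (Primrec.fst.comp Primrec.fst))
  · have hs : Primrec fun r : ((ℕ × List Bool × ℕ) × ℕ) × List Bool => r.1.1.2.2 :=
      Primrec.snd.comp (Primrec.snd.comp (Primrec.fst.comp Primrec.fst))
    have hy : Primrec fun r : ((ℕ × List Bool × ℕ) × ℕ) × List Bool => r.1.1.2.1 :=
      Primrec.fst.comp (Primrec.snd.comp (Primrec.fst.comp Primrec.fst))
    exact Primrec.eq.comp (Code.primrec_evaln.comp
      ((hs.pair (Primrec.const c)).pair (Primrec.snd.comp Primrec.fst)))
      (Primrec.option_some.comp (Primrec.encode.comp hy))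

lemma stageCount_pos_iff {c : Code} {K : ℕ} {y : List Bool} {s : ℕ} :
    0 < stageCount c K y s ↔ ∃ q : List Bool, q.length < K ∧
      Code.evaln s c (Encodable.encode q) = some (Encodable.encode y) := by
  unfold stageCount
  rw [Finset.sum_pos_iff]
  constructor
  · rintro ⟨e, -, he⟩
    rcases hq : Encodable.decode₂ (List Bool) e with _ | q
    · simp [hq] at he
    · have hqe : Encodable.encode q = e := Encodable.mem_decode₂.1 hq
      rw [hq, Option.elim_some] at he
      split_ifs at he with h
      · exact ⟨q, h.1, hqe ▸ h.2⟩
      · simp at he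
  · rintro ⟨q, hq, h⟩
    refine ⟨Encodable.encode q, Finset.mem_range.2 (Code.evaln_bound h), ?_⟩
    rw [Encodable.encodek₂, Option.elim_some, if_pos ⟨hq, h⟩]
    exact one_pos

lemma stageCount_pos_mono {c : Code} {K : ℕ} {y : List Bool} {s s' : ℕ} (hs : s ≤ s')
    (h : 0 < stageCount c K y s) : 0 < stageCount c K y s' := by
  obtain ⟨q, hq, h⟩ := stageCount_pos_iff.1 h
  exact stageCount_pos_iff.2 ⟨q, hq, Code.evaln_mono hs h⟩

lemma IsOptimalDecompressor.exists_stageCount {U : List Bool →. List Bool}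
    (hU : IsOptimalDecompressor U) :
    ∃ c : Code, ∀ K y, (∃ s, 0 < stageCount c K y s) ↔ plainComplexity U y < K := by
  obtain ⟨c, hc⟩ := Code.exists_code.1 hU.1
  refine ⟨c, fun K y => ?_⟩
  have hmem : ∀ q : List Bool, y ∈ U q ↔ ∃ s,
      Code.evaln s c (Encodable.encode q) = some (Encodable.encode y) := by
    intro q
    have := Code.evaln_complete (c := c) (n := Encodable.encode q) (x := Encodable.encode y)
    simp only [Option.mem_def] at this
    rw [← this, hc]
    simp [Encodable.encodek]
  rw [hU.plainComplexity_lt_iff]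
  simp only [stageCount_pos_iff, hmem]
  exact ⟨fun ⟨s, q, hq, h⟩ => ⟨q, hq, s, h⟩, fun ⟨q, hq, s, h⟩ => ⟨s, q, hq, h⟩⟩

/-- The integer `M ^ n` times the probability that `N_(t / M) (x) = y`, for lists of length `n`. -/
def listWeight (t M n : ℕ) (x y : List Bool) : ℕ :=
  ∏ i ∈ Finset.range n, if y[i]? = x[i]? then M - t else t

lemma primrec_listWeight : Primrec fun p : (ℕ × ℕ × ℕ) × List Bool × List Bool =>
    listWeight p.1.1 p.1.2.1 p.1.2.2 p.2.1 p.2.2 := by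
  refine primrec_prod_range (Primrec.snd.comp (Primrec.snd.comp Primrec.fst)) ?_
  have ht : Primrec fun r : ((ℕ × ℕ × ℕ) × List Bool × List Bool) × ℕ => r.1.1.1 :=
    Primrec.fst.comp (Primrec.fst.comp Primrec.fst)
  have hM : Primrec fun r : ((ℕ × ℕ × ℕ) × List Bool × List Bool) × ℕ => r.1.1.2.1 :=
    Primrec.fst.comp (Primrec.snd.comp (Primrec.fst.comp Primrec.fst))
  refine Primrec.ite (Primrec.eq.comp ?_ ?_) (Primrec.nat_sub.comp hM ht) ht
  · exact Primrec.list_getElem?.comp (Primrec.snd.comp (Primrec.snd.comp Primrec.fst)) Primrec.snd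
  · exact Primrec.list_getElem?.comp (Primrec.fst.comp (Primrec.snd.comp Primrec.fst)) Primrec.snd

lemma listWeight_ofFn {t M n : ℕ} (htM : t ≤ M) (hM : 0 < M) (x y : Fin n → Bool) :
    (listWeight t M n (List.ofFn x) (List.ofFn y) : ℝ)
      = (M : ℝ) ^ n * noiseWeight (t / M) x y := by
  have hM' : (M : ℝ) ≠ 0 := by exact_mod_cast hM.ne'
  unfold listWeight noiseWeight
  rw [Finset.prod_range]
  push_cast
  have : (M : ℝ) ^ n = ∏ _i : Fin n, (M : ℝ) := by simp
  rw [this, ← Finset.prod_mul_distrib]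
  refine Finset.prod_congr rfl fun i _ => ?_
  simp only [List.getElem?_ofFn, i.2, dif_pos, Fin.eta, Option.some.injEq]
  split_ifs
  · rw [Nat.cast_sub htM]; field_simp
  · field_simp

/-- A lower bound, available at stage `s` of the computation, for `M ^ n` times the probability
that `N_(t / M) (x)` has complexity less than `K`. -/
def stageSum (c : Code) (n K t M : ℕ) (x : List Bool) (s : ℕ) : ℕ :=
  ∑ e ∈ Finset.range s, (Encodable.decode₂ (List Bool) e).elim 0 fun y =>
    if y.length = n ∧ 0 < stageCount c K y s then listWeight t M n x y else 0

/-- The strings `x` of length `n` for which it is found by stage `s` that `N_(t / n²) (x)` has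
complexity less than `K` with probability at least `1 / (3 n)`; the parameters `n`, `K` and `t`
are coded by `m`. -/
def noisyLow (c : Code) (m : ℕ) (x : List Bool) (s : ℕ) : Bool :=
  decide (x.length = m.unpair.1 ∧ (m.unpair.1 ^ 2) ^ m.unpair.1 ≤ 3 * m.unpair.1 *
    stageSum c m.unpair.1 m.unpair.2.unpair.1 m.unpair.2.unpair.2 (m.unpair.1 ^ 2) x s)

lemma primrec_pow : Primrec₂ fun a b : ℕ => a ^ b :=
  Primrec₂.unpaired'.1 Nat.Primrec.pow

lemma primrec_stageSum (c : Code) : Primrec fun p : (ℕ × ℕ × ℕ × ℕ) × List Bool × ℕ =>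
    stageSum c p.1.1 p.1.2.1 p.1.2.2.1 p.1.2.2.2 p.2.1 p.2.2 := by
  refine primrec_sum_range (Primrec.snd.comp Primrec.snd) ?_
  refine primrec_option_elim (α := ((ℕ × ℕ × ℕ × ℕ) × List Bool × ℕ) × ℕ)
    (Primrec.decode₂.comp Primrec.snd) (Primrec.const 0) ?_
  have hm : Primrec fun r : (((ℕ × ℕ × ℕ × ℕ) × List Bool × ℕ) × ℕ) × List Bool => r.1.1.1 :=
    Primrec.fst.comp (Primrec.fst.comp Primrec.fst)
  have hx : Primrec fun r : (((ℕ × ℕ × ℕ × ℕ) × List Bool × ℕ) × ℕ) × List Bool => r.1.1.2.1 :=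
    Primrec.fst.comp (Primrec.snd.comp (Primrec.fst.comp Primrec.fst))
  have hs : Primrec fun r : (((ℕ × ℕ × ℕ × ℕ) × List Bool × ℕ) × ℕ) × List Bool => r.1.1.2.2 :=
    Primrec.snd.comp (Primrec.snd.comp (Primrec.fst.comp Primrec.fst))
  have hn := Primrec.fst.comp hm
  have hK := Primrec.fst.comp (Primrec.snd.comp hm)
  have ht := Primrec.fst.comp (Primrec.snd.comp (Primrec.snd.comp hm))
  have hM := Primrec.snd.comp (Primrec.snd.comp (Primrec.snd.comp hm))
  have hw := primrec_listWeight.comp ((ht.pair (hM.pair hn)).pair (hx.pair Primrec.snd))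
  have hc := (primrec_stageCount c).comp (hK.pair (Primrec.snd.pair hs))
  have h1 := Primrec.eq.comp (Primrec.list_length.comp Primrec.snd) hn
  have h2 := Primrec.nat_lt.comp (Primrec.const 0) hc
  exact Primrec.ite (h1.and h2) hw (Primrec.const 0)

lemma primrec_noisyLow (c : Code) :
    Primrec fun p : ℕ × List Bool × ℕ => noisyLow c p.1 p.2.1 p.2.2 := by
  have hn : Primrec fun m : ℕ => m.unpair.1 := Primrec.fst.comp Primrec.unpair
  have hKt : Primrec fun m : ℕ => m.unpair.2.unpair :=
    Primrec.unpair.comp (Primrec.snd.comp Primrec.unpair)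
  have hM : Primrec fun m : ℕ => m.unpair.1 ^ 2 := primrec_pow.comp hn (Primrec.const 2)
  have hm : Primrec fun m : ℕ =>
      (m.unpair.1, m.unpair.2.unpair.1, m.unpair.2.unpair.2, m.unpair.1 ^ 2) :=
    hn.pair ((Primrec.fst.comp hKt).pair ((Primrec.snd.comp hKt).pair hM))
  have hsum := (primrec_stageSum c).comp
    ((hm.comp (Primrec.fst (α := ℕ) (β := List Bool × ℕ))).pair Primrec.snd)
  have h1 : PrimrecPred fun p : ℕ × List Bool × ℕ => p.2.1.length = p.1.unpair.1 :=
    Primrec.eq.comp (Primrec.list_length.comp (Primrec.fst.comp Primrec.snd))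
      (hn.comp Primrec.fst)
  have h2 := Primrec.nat_le.comp (primrec_pow.comp (hM.comp Primrec.fst) (hn.comp Primrec.fst))
    (Primrec.nat_mul.comp (Primrec.nat_mul.comp (Primrec.const 3) (hn.comp Primrec.fst)) hsum)
  exact (h1.and h2).decide

lemma stageSum_le {c : Code} {n K t M : ℕ} {A : Finset (Fin n → Bool)}
    (hA : ∀ (y : Fin n → Bool) s, 0 < stageCount c K (List.ofFn y) s → y ∈ A)
    (x : List Bool) (s : ℕ) :
    stageSum c n K t M x s ≤ ∑ y ∈ A, listWeight t M n x (List.ofFn y) := by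
  classical
  have hinj : Function.Injective fun y : Fin n → Bool => Encodable.encode (List.ofFn y) :=
    Encodable.encode_injective.comp List.ofFn_injective
  have h1 : stageSum c n K t M x s ≤ ∑ e ∈ A.image (fun y => Encodable.encode (List.ofFn y)),
      (Encodable.decode₂ (List Bool) e).elim 0 fun y =>
        if y.length = n ∧ 0 < stageCount c K y s then listWeight t M n x y else 0 := by
    refine Finset.sum_le_sum_of_ne_zero fun e _ he => ?_
    rcases hq : Encodable.decode₂ (List Bool) e with _ | y
    · simp [hq] at he
    · have hqe : Encodable.encode y = e := Encodable.mem_decode₂.1 hq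
      rw [hq, Option.elim_some] at he
      split_ifs at he with h
      · obtain ⟨hlen, hpos⟩ := h
        subst hlen
        refine Finset.mem_image.2 ⟨y.get, hA y.get s (by rwa [List.ofFn_get]), ?_⟩
        rw [List.ofFn_get, hqe]
      · exact absurd rfl he
  refine h1.trans ?_
  rw [Finset.sum_image hinj.injOn]
  refine Finset.sum_le_sum fun y _ => ?_
  rw [Encodable.encodek₂, Option.elim_some]
  split_ifs
  · exact le_rfl
  · exact Nat.zero_le _

lemma exists_le_stageSum {c : Code} {n K t M : ℕ} {A : Finset (Fin n → Bool)}
    (hA : ∀ y ∈ A, ∃ s, 0 < stageCount c K (List.ofFn y) s) (x : List Bool) :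
    ∃ s, ∑ y ∈ A, listWeight t M n x (List.ofFn y) ≤ stageSum c n K t M x s := by
  classical
  choose! f hf using hA
  have hinj : Function.Injective fun y : Fin n → Bool => Encodable.encode (List.ofFn y) :=
    Encodable.encode_injective.comp List.ofFn_injective
  set s := ∑ y ∈ A, (f y + Encodable.encode (List.ofFn y) + 1) with hs
  have hle : ∀ y ∈ A, f y + Encodable.encode (List.ofFn y) + 1 ≤ s := fun y hy =>
    Finset.single_le_sum (f := fun y => f y + Encodable.encode (List.ofFn y) + 1)
      (fun _ _ => Nat.zero_le _) hy
  refine ⟨s, ?_⟩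
  have hsub : A.image (fun y => Encodable.encode (List.ofFn y)) ⊆ Finset.range s := by
    intro e he
    obtain ⟨y, hy, rfl⟩ := Finset.mem_image.1 he
    have := hle y hy
    exact Finset.mem_range.2 (by omega)
  refine le_trans ?_ (Finset.sum_le_sum_of_subset hsub)
  rw [Finset.sum_image hinj.injOn]
  refine Finset.sum_le_sum fun y hy => ?_
  have := hle y hy
  rw [Encodable.encodek₂, Option.elim_some, if_pos ⟨List.length_ofFn,
    stageCount_pos_mono (by omega) (hf y hy)⟩]

/-- The strings that the noise, with probability at least `1 / (3 n)`, sends to strings of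
complexity less than `K` form an enumerable set; so all of them are simple if they are few. -/
theorem IsOptimalDecompressor.KS_le_of_noisy {U : List Bool →. List Bool}
    (hU : IsOptimalDecompressor U) :
    ∃ c : ℕ, ∀ (n K t a k : ℕ) (A B : Finset (Fin n → Bool)), 0 < n → t ≤ n ^ 2 →
      (∀ y, y ∈ A ↔ KS U y < K) →
      (∀ z, 1 ≤ 3 * n * ∑ y ∈ A, noiseWeight (t / (n ^ 2 : ℕ)) z y ↔ z ∈ B) →
      B.card ≤ 2 ^ k → Nat.pair n (Nat.pair K t) < 2 ^ a →
      ∀ x ∈ B, KS U x ≤ k + 2 * a + c := by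
  classical
  obtain ⟨code, hcode⟩ := hU.exists_stageCount
  obtain ⟨c, hc⟩ := hU.plainComplexity_le_of_enumerable (primrec_noisyLow code)
  refine ⟨c, fun n K t a k A B hn ht hA hB hcard ha x hx => ?_⟩
  have hM : 0 < n ^ 2 := by positivity
  have key : ∀ z : Fin n → Bool, (n ^ 2) ^ n ≤ 3 * n *
      ∑ y ∈ A, listWeight t (n ^ 2) n (List.ofFn z) (List.ofFn y) ↔ z ∈ B := by
    intro z
    rw [← hB z, ← Nat.cast_le (α := ℝ), Nat.cast_mul, Nat.cast_sum]
    simp_rw [listWeight_ofFn ht hM]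
    rw [← Finset.mul_sum, Nat.cast_pow (n ^ 2) n]
    have hMn : (0 : ℝ) < ((n ^ 2 : ℕ) : ℝ) ^ n := by positivity
    rw [mul_left_comm, le_mul_iff_one_le_right hMn]
    push_cast
    rfl
  have hpair : ∀ z s, noisyLow code (Nat.pair n (Nat.pair K t)) z s = true ↔
      z.length = n ∧ (n ^ 2) ^ n ≤ 3 * n * stageSum code n K t (n ^ 2) z s := by
    intro z s
    simp only [noisyLow, Nat.unpair_pair, decide_eq_true_eq]
  have hlow : ∀ y : Fin n → Bool, (∃ s, 0 < stageCount code K (List.ofFn y) s) ↔ y ∈ A :=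
    fun y => (hcode K (List.ofFn y)).trans (hA y).symm
  obtain ⟨s, hs⟩ := exists_le_stageSum (t := t) (M := n ^ 2) (fun y hy => (hlow y).2 hy)
    (List.ofFn x)
  refine hc (Nat.pair n (Nat.pair K t)) a k (B.image List.ofFn) (fun y s' hy => ?_)
    (Finset.card_image_le.trans hcard) ha (List.ofFn x) s ((hpair _ _).2 ⟨List.length_ofFn, ?_⟩)
  · obtain ⟨hlen, h⟩ := (hpair _ _).1 hy
    subst hlen
    refine Finset.mem_image.2 ⟨y.get, (key y.get).1 ?_, List.ofFn_get y⟩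
    rw [List.ofFn_get]
    exact h.trans (Nat.mul_le_mul_left _ (stageSum_le (fun y s h => (hlow y).1 ⟨s, h⟩) _ _))
  · exact ((key x).2 hx).trans (Nat.mul_le_mul_left _ hs)

/-- The number of ones in a bit string. -/
def ones {n : ℕ} (x : Fin n → Bool) : ℕ := ∑ i, if x i = true then 1 else 0

/-- A string with a given number of ones is determined by its length, its number of ones, and its
position among the strings with the same length and number of ones. -/
theorem IsOptimalDecompressor.KS_le_of_ones {U : List Bool →. List Bool}
    (hU : IsOptimalDecompressor U) :
    ∃ c : ℕ, ∀ (n w a k : ℕ), (Finset.univ.filter fun y : Fin n → Bool => ones y = w).card ≤ 2 ^ k →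
      Nat.pair n w < 2 ^ a → ∀ x : Fin n → Bool, ones x = w → KS U x ≤ k + 2 * a + c := by
  classical
  let R : ℕ → List Bool → ℕ → Bool := fun m x _ =>
    decide (x.length = m.unpair.1 ∧
      ∑ i ∈ Finset.range m.unpair.1, (if x[i]? = some true then 1 else 0) = m.unpair.2)
  have hR : Primrec fun p : ℕ × List Bool × ℕ => R p.1 p.2.1 p.2.2 := by
    have hn : Primrec fun p : ℕ × List Bool × ℕ => p.1.unpair.1 :=
      Primrec.fst.comp (Primrec.unpair.comp Primrec.fst)
    have hx : Primrec fun p : ℕ × List Bool × ℕ => p.2.1 := Primrec.fst.comp Primrec.snd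
    have h1 := Primrec.eq.comp (Primrec.list_length.comp hx) hn
    have h2 := Primrec.eq.comp (primrec_sum_range (g := fun (p : ℕ × List Bool × ℕ) i =>
      if p.2.1[i]? = some true then 1 else 0) hn (Primrec.ite (Primrec.eq.comp
        (Primrec.list_getElem?.comp (hx.comp Primrec.fst) Primrec.snd)
        (Primrec.const (some true))) (Primrec.const 1) (Primrec.const 0)))
      (Primrec.snd.comp (Primrec.unpair.comp (Primrec.fst (α := ℕ) (β := List Bool × ℕ))))
    exact (h1.and h2).decide
  obtain ⟨c, hc⟩ := hU.plainComplexity_le_of_enumerable hR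
  have hones : ∀ {n : ℕ} (x : Fin n → Bool),
      ∑ i ∈ Finset.range n, (if (List.ofFn x)[i]? = some true then 1 else 0) = ones x := by
    intro n x
    rw [Finset.sum_range]
    simp [ones]
  refine ⟨c, fun n w a k hcard ha x hx => ?_⟩
  refine hc (Nat.pair n w) a k ((Finset.univ.filter fun y : Fin n → Bool => ones y = w).image
    List.ofFn) (fun y s hy => ?_) (Finset.card_image_le.trans hcard) ha (List.ofFn x) 0 ?_
  · simp only [R, Nat.unpair_pair, decide_eq_true_eq] at hy
    obtain ⟨hlen, h⟩ := hy
    subst hlen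
    refine Finset.mem_image.2 ⟨y.get, Finset.mem_filter.2 ⟨Finset.mem_univ _, ?_⟩, List.ofFn_get y⟩
    rw [← hones, List.ofFn_get, h]
  · simp only [R, Nat.unpair_pair, decide_eq_true_eq]
    exact ⟨List.length_ofFn, by rw [hones, hx]⟩

/-- There are fewer than `2 ^ K` strings of complexity less than `K`. -/
lemma IsOptimalDecompressor.card_KS_lt {U : List Bool →. List Bool}
    (hU : IsOptimalDecompressor U) {n K : ℕ}
    (A : Finset (Fin n → Bool)) (hA : ∀ y ∈ A, KS U y < K) : A.card < 2 ^ K := by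
  classical
  choose f hf hmem using fun y : Fin n → Bool => hU.exists_program (List.ofFn y)
  -- a program `q` of length less than `K` is counted by the digits of `q` followed by a one
  have hlt : ∀ q : List Bool, 0 < bitVal (q ++ [true]) ∧ bitVal (q ++ [true]) < 2 ^ (q.length + 1) :=
    fun q => ⟨by rw [bitVal_append]; simp [bitVal],
      by simpa using bitVal_lt (q ++ [true])⟩
  have hinjq : ∀ q q' : List Bool, bitVal (q ++ [true]) = bitVal (q' ++ [true]) → q = q' := by
    intro q
    induction q with
    | nil =>
      intro q' h
      cases q' with
      | nil => rfl
      | cons b q' =>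
        have := (hlt q').1
        simp only [List.nil_append, List.cons_append, bitVal, Bool.toNat_true] at h
        omega
    | cons b q ih =>
      intro q' h
      cases q' with
      | nil =>
        have := (hlt q).1
        simp only [List.nil_append, List.cons_append, bitVal, Bool.toNat_true] at h
        omega
      | cons b' q' =>
        simp only [List.cons_append, bitVal] at h
        have hb : b = b' := by
          cases b <;> cases b' <;> simp at h ⊢ <;> omega
        subst hb
        rw [ih q' (by omega)]
  have hcard : A.card ≤ (Finset.Ico 1 (2 ^ K)).card := by
    refine Finset.card_le_card_of_injOn (fun y => bitVal (f y ++ [true])) (fun y hy => ?_)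
      (fun y _ y' _ h => ?_)
    · have h1 := hlt (f y)
      have h2 : (f y).length + 1 ≤ K := by rw [hf]; exact hA y hy
      simp only [Finset.coe_Ico, Set.mem_Ico]
      exact ⟨h1.1, h1.2.trans_le (Nat.pow_le_pow_right (by norm_num) h2)⟩
    · have h1 := hmem y
      rw [hinjq _ _ h] at h1
      exact List.ofFn_injective (Part.mem_unique h1 (hmem y'))
  rw [Nat.card_Ico] at hcard
  have : 0 < 2 ^ K := by positivity
  omega

/-! ### Noise increases complexity -/

/-- For large `n` the noise level can be replaced by a multiple of `1 / n²`, at the cost of a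
constant factor in all probabilities. -/
lemma exists_rational_noise {τ : ℝ} (hτ0 : 0 < τ) (hτ1 : τ < 1) :
    ∀ᶠ n : ℕ in atTop, ∃ t : ℕ, t ≤ n ^ 2 ∧ ∀ x y : Fin n → Bool,
      noiseWeight (t / (n ^ 2 : ℕ)) x y ≤ 3 * noiseWeight τ x y ∧
      noiseWeight τ x y ≤ 3 * noiseWeight (t / (n ^ 2 : ℕ)) x y := by
  have hlarge := tendsto_natCast_atTop_atTop (R := ℝ)
  filter_upwards [hlarge.eventually_ge_atTop (2 / τ), hlarge.eventually_ge_atTop (1 / (1 - τ)),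
    eventually_ge_atTop 2] with n hn1 hn2 hn
  have hn' : (2 : ℝ) ≤ n := by exact_mod_cast hn
  rw [div_le_iff₀ hτ0] at hn1
  rw [div_le_iff₀ (by linarith)] at hn2
  have hM : (0 : ℝ) < (n : ℝ) ^ 2 := by positivity
  set t := ⌊τ * (n : ℝ) ^ 2⌋₊ with ht
  have h1 : (t : ℝ) ≤ τ * (n : ℝ) ^ 2 := Nat.floor_le (by positivity)
  have h2 : τ * (n : ℝ) ^ 2 < t + 1 := Nat.lt_floor_add_one _
  have htn : t ≤ n ^ 2 := by
    have : (t : ℝ) ≤ (n : ℝ) ^ 2 := by nlinarith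
    exact_mod_cast this
  refine ⟨t, htn, ?_⟩
  push_cast
  set τ' : ℝ := t / (n : ℝ) ^ 2 with hτ'
  have e : τ' * (n : ℝ) ^ 2 = t := by rw [hτ']; field_simp
  have hle : τ' ≤ τ := by rw [hτ', div_le_iff₀ hM]; exact h1
  have hτ'0 : 0 ≤ τ' := by positivity
  have hge : 1 ≤ n * τ' := by
    have : (1 : ℝ) * n ≤ n * τ' * n := by nlinarith
    exact le_of_mul_le_mul_right this (by linarith)
  -- both noise levels agree up to a factor `1 + 1 / n` in each coordinate
  have hf : (1 + 1 / (n : ℝ)) ^ n ≤ 3 := by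
    have h : 1 + 1 / (n : ℝ) ≤ Real.exp (1 / n) := by
      have := Real.add_one_le_exp (1 / (n : ℝ)); linarith
    calc (1 + 1 / (n : ℝ)) ^ n ≤ Real.exp (1 / n) ^ n := pow_le_pow_left₀ (by positivity) h n
      _ = Real.exp 1 := by rw [← Real.exp_nat_mul]; congr 1; field_simp
      _ ≤ 3 := by linarith [Real.exp_one_lt_d9]
  have hprod : ∀ {u v : ℝ}, 0 ≤ u → u ≤ 1 → 0 ≤ v → v ≤ 1 → u ≤ (1 + 1 / (n : ℝ)) * v →
      1 - u ≤ (1 + 1 / (n : ℝ)) * (1 - v) → ∀ x y : Fin n → Bool,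
        noiseWeight u x y ≤ 3 * noiseWeight v x y := by
    intro u v hu0 hu1 hv0 hv1 huv huv' x y
    calc noiseWeight u x y ≤ ∏ i, ((1 + 1 / (n : ℝ)) * bitNoise v (x i) (y i)) := by
          refine Finset.prod_le_prod (fun i _ => bitNoise_nonneg hu0 hu1 _ _) fun i _ => ?_
          unfold bitNoise
          split_ifs
          · exact huv'
          · exact huv
      _ = (1 + 1 / (n : ℝ)) ^ n * noiseWeight v x y := by
          rw [Finset.prod_mul_distrib, noiseWeight_eq_prod]; simp
      _ ≤ _ := mul_le_mul_of_nonneg_right hf (noiseWeight_nonneg hv0 hv1 x y)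
  have hnn : (0 : ℝ) < n := by linarith
  have hinv : ∀ v : ℝ, (1 + 1 / (n : ℝ)) * v = v + v / n := fun v => by ring
  have hτn : 0 ≤ τ / n := by positivity
  have hstep : τ ≤ τ' + 1 / (n : ℝ) ^ 2 := by
    have : τ * (n : ℝ) ^ 2 ≤ (τ' + 1 / (n : ℝ) ^ 2) * (n : ℝ) ^ 2 := by
      rw [add_mul, e]; field_simp; linarith
    exact le_of_mul_le_mul_right this hM
  have hfrac : ∀ v : ℝ, 1 ≤ n * v → 1 / (n : ℝ) ^ 2 ≤ v / n := by
    intro v hv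
    rw [div_le_div_iff₀ hM hnn]
    nlinarith
  refine fun x y => ⟨hprod hτ'0 (by linarith) hτ0.le hτ1.le ?_ ?_ x y,
    hprod hτ0.le hτ1.le hτ'0 (by linarith) ?_ ?_ x y⟩
  · rw [hinv]; linarith
  · rw [hinv]
    have := hfrac (1 - τ) (by linarith)
    linarith
  · rw [hinv]
    have := hfrac τ' hge
    linarith
  · rw [hinv]
    have : 0 ≤ (1 - τ') / n := div_nonneg (by linarith) hnn.le
    linarith

/-- If the noise sends each string of `B` with a non-negligible probability to the set `A`, then
the size of `A` is bounded from below in terms of that of `B`: the neighbourhood of `A` carries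
nearly all of the noisy version of the uniform distribution on `B`, whose entropy is large. -/
theorem log_card_noisy_preimage_le {τ s κ : ℝ} (hτ0 : 0 ≤ τ) (hτ1 : τ ≤ 1)
    (hs : ∀ r ∈ Set.Icc (0 : ℝ) 1,
      s * Real.binEntropy r + κ ≤ Real.binEntropy (noiseParam r τ))
    {n : ℕ} (hn : 0 < n) {A B : Finset (Fin n → Bool)} (hB : B.Nonempty)
    (hAB : ∀ x ∈ B, 1 ≤ 9 * n * ∑ y ∈ A, noiseWeight τ x y) {r : ℕ}
    (hr : 9 * (n : ℝ) ^ 2 * Real.exp (-(r : ℝ) ^ 2 / (2 * n)) ≤ 1) :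
    s * Real.log B.card + n * κ ≤ r * Real.log (n + 1) + Real.log A.card + 3 := by
  classical
  have hn' : (0 : ℝ) < n := by exact_mod_cast hn
  set S := hammingNhd A r with hS
  set P : (Fin n → Bool) → ℝ := fun x => if x ∈ B then (1 : ℝ) / B.card else 0 with hP
  have hP0 : ∀ x, 0 ≤ P x := fun x => by
    simp only [hP]; split_ifs <;> positivity
  have hc : (B.card : ℝ) ≠ 0 := by exact_mod_cast hB.card_pos.ne'
  have hP1 : ∑ x, P x = 1 := by simp [hP, Finset.sum_ite_mem, hc]
  have hA : A.Nonempty := by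
    obtain ⟨x, hx⟩ := hB
    by_contra h
    have := hAB x hx
    rw [Finset.not_nonempty_iff_eq_empty.1 h] at this
    norm_num at this
  have hAS : A ⊆ S := fun a ha =>
    Finset.mem_filter.2 ⟨Finset.mem_univ _, a, ha, by simp⟩
  have hsmall : ∀ x ∈ B, n * ∑ y ∈ Sᶜ, noiseWeight τ x y ≤ 1 := by
    intro x hx
    have h1 := sum_compl_hammingNhd_le hτ0 hτ1 hn x A r
    have h2 := hAB x hx
    have h3 : 0 ≤ ∑ y ∈ Sᶜ, noiseWeight τ x y :=
      Finset.sum_nonneg fun y _ => noiseWeight_nonneg hτ0 hτ1 x y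
    calc n * ∑ y ∈ Sᶜ, noiseWeight τ x y
        = n * (1 * ∑ y ∈ Sᶜ, noiseWeight τ x y) := by rw [one_mul]
      _ ≤ n * ((9 * n * ∑ y ∈ A, noiseWeight τ x y) * ∑ y ∈ Sᶜ, noiseWeight τ x y) := by
          gcongr
      _ = 9 * (n : ℝ) ^ 2 * ((∑ y ∈ A, noiseWeight τ x y) * ∑ y ∈ Sᶜ, noiseWeight τ x y) := by
          ring
      _ ≤ 9 * (n : ℝ) ^ 2 * Real.exp (-(r : ℝ) ^ 2 / (2 * n)) := by gcongr
      _ ≤ 1 := hr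
  have hconc : n * ∑ y ∈ Sᶜ, noisy τ P y ≤ 1 := by
    calc n * ∑ y ∈ Sᶜ, noisy τ P y = ∑ x, P x * (n * ∑ y ∈ Sᶜ, noiseWeight τ x y) := by
          unfold noisy
          rw [Finset.sum_comm, Finset.mul_sum]
          refine Finset.sum_congr rfl fun x _ => ?_
          rw [← Finset.mul_sum]; ring
      _ ≤ ∑ x, P x := by
          refine Finset.sum_le_sum fun x _ => ?_
          by_cases hx : x ∈ B
          · exact mul_le_of_le_one_right (hP0 x) (hsmall x hx)
          · simp [hP, hx]
      _ = 1 := hP1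
  have hup := massEntropy_le_of_concentrated (noisy_nonneg hτ0 hτ1 hP0)
    ((sum_noisy τ P).trans hP1) (hA.mono hAS) hconc
  have hlow := le_massEntropy_noisy hτ0 hτ1 hs hP0
  rw [massEntropy_uniform hB, hP1, mul_one] at hlow
  have hcard : Real.log S.card ≤ r * Real.log (n + 1) + Real.log A.card := by
    have hA0 : (0 : ℝ) < A.card := by exact_mod_cast hA.card_pos
    have hS0 : (0 : ℝ) < S.card := by exact_mod_cast (hA.mono hAS).card_pos
    have h : (S.card : ℝ) ≤ ((n : ℝ) + 1) ^ r * A.card := by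
      exact_mod_cast card_hammingNhd_le A r
    rw [← Real.log_pow, ← Real.log_mul (by positivity) hA0.ne']
    exact Real.log_le_log hS0 h
  linarith

lemma pair_lt_two_pow {n K t : ℕ} (hn : 2 ≤ n) (hK : K ≤ n) (ht : t ≤ n ^ 2) :
    Nat.pair n (Nat.pair K t) < 2 ^ (14 * Nat.clog 2 n) := by
  have h1 : Nat.pair K t < n ^ 6 := by
    refine (Nat.pair_lt_max_add_one_sq K t).trans_le ?_
    have h : max K t + 1 ≤ n ^ 3 := by
      have : max K t ≤ n ^ 2 := max_le (hK.trans (by nlinarith)) ht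
      have h3 : n ^ 3 = n * n ^ 2 := by ring
      nlinarith
    calc (max K t + 1) ^ 2 ≤ (n ^ 3) ^ 2 := Nat.pow_le_pow_left h 2
      _ = n ^ 6 := by ring
  have h2 : Nat.pair n (Nat.pair K t) < n ^ 14 := by
    refine (Nat.pair_lt_max_add_one_sq _ _).trans_le ?_
    have h : max n (Nat.pair K t) + 1 ≤ n ^ 7 := by
      have h6 : n ≤ n ^ 6 := Nat.le_self_pow (by norm_num) n
      have : max n (Nat.pair K t) ≤ n ^ 6 := max_le h6 h1.le
      have h7 : n ^ 7 = n * n ^ 6 := by ring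
      nlinarith
    calc (max n (Nat.pair K t) + 1) ^ 2 ≤ (n ^ 7) ^ 2 := Nat.pow_le_pow_left h 2
      _ = n ^ 14 := by ring
  refine h2.trans_le ?_
  calc n ^ 14 ≤ (2 ^ Nat.clog 2 n) ^ 14 := Nat.pow_le_pow_left (Nat.le_pow_clog (by norm_num) n) 14
    _ = 2 ^ (14 * Nat.clog 2 n) := by rw [← pow_mul, mul_comm]

lemma clog_mul_log_two_le {b : ℕ} (hb : 0 < b) :
    (Nat.clog 2 b : ℝ) * Real.log 2 ≤ Real.log b + Real.log 2 := by
  have hl := Real.log_pos one_lt_two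
  rcases Nat.lt_or_ge 1 b with h | h
  · have h1 := Nat.pow_pred_clog_lt_self (b := 2) (by norm_num) h
    have h2 : 0 < Nat.clog 2 b := Nat.clog_pos (by norm_num) h
    have h3 : (2 : ℝ) ^ (Nat.clog 2 b).pred ≤ b := by exact_mod_cast h1.le
    have h4 := Real.log_le_log (by positivity) h3
    rw [Real.log_pow, Nat.pred_eq_sub_one, Nat.cast_sub h2] at h4
    push_cast at h4
    linarith
  · have : b = 1 := by omega
    subst this
    simp [hl.le]

lemma noiseProb_setOf_not (τ : ℝ) {n : ℕ} (x : Fin n → Bool) (A : Finset (Fin n → Bool)) :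
    noiseProb τ x {y | y ∉ A} = 1 - ∑ y ∈ A, noiseWeight τ x y := by
  classical
  have h : {y | y ∉ A} = ((Aᶜ : Finset (Fin n → Bool)) : Set (Fin n → Bool)) := by
    ext y; simp
  rw [h, noiseProb_eq_sum_filter, ← sum_noiseWeight τ x, ← Finset.sum_add_sum_compl A]
  ring

/-- Bounds for the error term `√n (log₂ n) ^ (3 / 2) = √(n log₂ n) log₂ n` and its factors. -/
lemma errorTerm_facts {n : ℕ} (hn : 3 ≤ n) :
    Real.log n = Real.logb 2 n * Real.log 2 ∧ 1 ≤ Real.logb 2 n ∧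
      Real.sqrt n * Real.logb 2 n ^ (3 / 2 : ℝ)
        = Real.sqrt (n * Real.logb 2 n) * Real.logb 2 n ∧
      1 < Real.sqrt (n * Real.logb 2 n) := by
  have hn' : (3 : ℝ) ≤ n := by exact_mod_cast hn
  have hn0 : (0 : ℝ) < n := by linarith
  have hl2 := Real.log_pos one_lt_two
  set L := Real.logb 2 n with hL
  have hLlog : Real.log n = L * Real.log 2 := by rw [hL, Real.logb]; field_simp
  have hL1 : 1 ≤ L := by
    rw [hL, Real.le_logb_iff_rpow_le one_lt_two hn0]
    norm_num; linarith
  refine ⟨hLlog, hL1, ?_, ?_⟩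
  · rw [Real.sqrt_mul hn0.le, show (3 / 2 : ℝ) = 1 / 2 + 1 by norm_num,
      Real.rpow_add (by linarith), Real.rpow_one, ← Real.sqrt_eq_rpow]
    ring
  · rw [Real.lt_sqrt (by norm_num)]; nlinarith

/-- A radius for the blowing-up lemma that makes the exceptional probability smaller than `1 / n`
and the neighbourhoods larger only by the factor allowed in the error term. -/
lemma exists_blowup_radius {n : ℕ} (hn : 3 ≤ n) : ∃ r : ℕ,
    9 * (n : ℝ) ^ 2 * Real.exp (-(r : ℝ) ^ 2 / (2 * n)) ≤ 1 ∧
    r * Real.log (n + 1) ≤ 8 * (Real.sqrt n * Real.logb 2 n ^ (3 / 2 : ℝ)) * Real.log 2 := by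
  obtain ⟨hLlog, hL1, hE', hq1⟩ := errorTerm_facts hn
  rw [hE']
  have hn' : (3 : ℝ) ≤ n := by exact_mod_cast hn
  have hn0 : (0 : ℝ) < n := by linarith
  have hl2 := Real.log_pos one_lt_two
  have hl2' : Real.log 2 ≤ 1 := by linarith [Real.log_two_lt_d9]
  set L := Real.logb 2 n with hL
  -- the radius is chosen so that `9 n² exp (-r² / (2 n)) ≤ 9 / n² ≤ 1`
  set r := ⌈Real.sqrt (8 * n * Real.log n)⌉₊ with hr
  have hlogn : 0 ≤ Real.log n := Real.log_natCast_nonneg n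
  have hr1 : 8 * n * Real.log n ≤ (r : ℝ) ^ 2 := by
    have := Nat.le_ceil (Real.sqrt (8 * n * Real.log n))
    calc 8 * n * Real.log n = Real.sqrt (8 * n * Real.log n) ^ 2 :=
          (Real.sq_sqrt (by positivity)).symm
      _ ≤ (r : ℝ) ^ 2 := pow_le_pow_left₀ (Real.sqrt_nonneg _) this 2
  have hr2 : 9 * (n : ℝ) ^ 2 * Real.exp (-(r : ℝ) ^ 2 / (2 * n)) ≤ 1 := by
    have h1 : Real.exp (-(r : ℝ) ^ 2 / (2 * n)) ≤ Real.exp (-(4 * Real.log n)) := by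
      apply Real.exp_le_exp.2
      rw [div_le_iff₀ (by positivity)]
      nlinarith
    have h2 : Real.exp (-(4 * Real.log n)) = ((n : ℝ) ^ 4)⁻¹ := by
      rw [Real.exp_neg, show (4 : ℝ) * Real.log n = ((4 : ℕ) : ℝ) * Real.log n by norm_num,
        Real.exp_nat_mul, Real.exp_log hn0]
    rw [h2] at h1
    calc 9 * (n : ℝ) ^ 2 * Real.exp (-(r : ℝ) ^ 2 / (2 * n)) ≤ 9 * (n : ℝ) ^ 2 * ((n : ℝ) ^ 4)⁻¹ := by
          gcongr
      _ = 9 / (n : ℝ) ^ 2 := by field_simp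
      _ ≤ 1 := by rw [div_le_one (by positivity)]; nlinarith
  have hr3 : (r : ℝ) ≤ 4 * Real.sqrt (n * L) := by
    have h1 : (r : ℝ) < Real.sqrt (8 * n * Real.log n) + 1 := Nat.ceil_lt_add_one (Real.sqrt_nonneg _)
    have h2 : Real.sqrt (8 * n * Real.log n) ≤ 3 * Real.sqrt (n * L) := by
      rw [Real.sqrt_le_left (by positivity), mul_pow, Real.sq_sqrt (by positivity), hLlog]
      have : (n : ℝ) * L * Real.log 2 ≤ n * L * 1 := by gcongr
      nlinarith [mul_nonneg hn0.le (zero_le_one.trans hL1)]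
    linarith
  have hlogn1 : Real.log (n + 1) ≤ 2 * L * Real.log 2 := by
    have h1 : Real.log ((n : ℝ) + 1) ≤ Real.log ((n : ℝ) ^ 2) :=
      Real.log_le_log (by linarith) (by nlinarith)
    rw [Real.log_pow, hLlog] at h1
    push_cast at h1
    linarith
  have hrE : r * Real.log (n + 1) ≤ 8 * (Real.sqrt (n * L) * L) * Real.log 2 := by
    calc r * Real.log (n + 1) ≤ (4 * Real.sqrt (n * L)) * (2 * L * Real.log 2) := by
          apply mul_le_mul hr3 hlogn1 (Real.log_nonneg (by linarith)) (by positivity)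
      _ = 8 * (Real.sqrt (n * L) * L) * Real.log 2 := by ring
  exact ⟨r, hr2, hrE⟩

/-- Noise increases Kolmogorov complexity. -/
theorem IsOptimalDecompressor.exists_noise_bound {U : List Bool →. List Bool}
    (hU : IsOptimalDecompressor U) :
    ∃ c : ℝ, ∀ p τ : ℝ, 0 ≤ p → p ≤ 1 / 2 → 0 < τ → τ < 1 →
      ∀ᶠ n : ℕ in atTop, ∀ x : Fin n → Bool,
        entropyBits p * (n : ℝ) ≤ (KS U x : ℝ) →
          1 - 1 / (n : ℝ) ≤ noiseProb τ x {y : Fin n → Bool |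
            entropyBits (noiseParam p τ) * (n : ℝ)
              - c * (Real.sqrt (n : ℝ) * Real.logb 2 (n : ℝ) ^ (3 / 2 : ℝ)) ≤ (KS U y : ℝ)} := by
  classical
  obtain ⟨c, hc⟩ := hU.KS_le_of_noisy
  refine ⟨72 + c, fun p τ hp0 hp1 hτ0 hτ1 => ?_⟩
  obtain ⟨s, hs0, hs1, hs⟩ := exists_noise_slope hp0 hp1 hτ0 hτ1
  filter_upwards [exists_rational_noise hτ0 hτ1, eventually_ge_atTop 3] with n ht hn x hx
  obtain ⟨t, htn, hw⟩ := ht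
  have hn' : (3 : ℝ) ≤ n := by exact_mod_cast hn
  have hn0 : (0 : ℝ) < n := by linarith
  have hl2 := Real.log_pos one_lt_two
  have hl2'' : 1 / 2 ≤ Real.log 2 := by linarith [Real.log_two_gt_d9]
  set L := Real.logb 2 n with hL
  set E := Real.sqrt n * L ^ (3 / 2 : ℝ) with hE
  obtain ⟨hLlog, hL1, hE', hq1⟩ := errorTerm_facts hn
  rw [← hL] at hLlog hL1 hE' hq1
  rw [← hE] at hE'
  have hEL : L < E := by rw [hE']; nlinarith
  set θ := entropyBits (noiseParam p τ) * (n : ℝ) - (72 + c) * E with hθ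
  set K := ⌈θ⌉₊ with hK
  set A : Finset (Fin n → Bool) := Finset.univ.filter fun y => KS U y < K with hA
  have hAmem : ∀ y, y ∈ A ↔ KS U y < K := fun y => by simp [hA]
  have hev : {y : Fin n → Bool | θ ≤ (KS U y : ℝ)} = {y | y ∉ A} := by
    ext y
    simp only [Set.mem_ofPred_eq, hAmem, hK, Nat.lt_ceil, not_lt]
  rw [hev, noiseProb_setOf_not]
  by_contra hcon
  have hgt : 1 / (n : ℝ) < ∑ y ∈ A, noiseWeight τ x y := by linarith
  rw [div_lt_iff₀ hn0] at hgt
  set B : Finset (Fin n → Bool) := Finset.univ.filter fun z =>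
    1 ≤ 3 * n * ∑ y ∈ A, noiseWeight (t / (n ^ 2 : ℕ)) z y with hB
  have hBmem : ∀ z, 1 ≤ 3 * n * ∑ y ∈ A, noiseWeight (t / (n ^ 2 : ℕ)) z y ↔ z ∈ B :=
    fun z => by simp [hB]
  have hxB : x ∈ B := by
    rw [← hBmem]
    have : ∑ y ∈ A, noiseWeight τ x y ≤ 3 * ∑ y ∈ A, noiseWeight (t / (n ^ 2 : ℕ)) x y := by
      rw [Finset.mul_sum]
      exact Finset.sum_le_sum fun y _ => (hw x y).2
    nlinarith
  have hBne : B.Nonempty := ⟨x, hxB⟩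
  have hAB : ∀ z ∈ B, 1 ≤ 9 * n * ∑ y ∈ A, noiseWeight τ z y := by
    intro z hz
    have h1 := (hBmem z).2 hz
    have : ∑ y ∈ A, noiseWeight (t / (n ^ 2 : ℕ)) z y ≤ 3 * ∑ y ∈ A, noiseWeight τ z y := by
      rw [Finset.mul_sum]
      exact Finset.sum_le_sum fun y _ => (hw z y).1
    nlinarith
  have hβ : entropyBits (noiseParam p τ) * Real.log 2 = Real.binEntropy (noiseParam p τ) := by
    unfold entropyBits; field_simp
  have hα : entropyBits p * Real.log 2 = Real.binEntropy p := by
    unfold entropyBits; field_simp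
  have hβ1 : entropyBits (noiseParam p τ) ≤ 1 := by
    unfold entropyBits
    rw [div_le_one hl2]
    exact Real.binEntropy_le_log_two
  have hcE : 0 ≤ (72 + (c : ℝ)) * E := by positivity
  have hKn : K ≤ n := by
    rw [hK]
    refine Nat.ceil_le.2 ?_
    nlinarith
  -- the complexity of `x` shows that `B` is large
  have hKS := hc n K t (14 * Nat.clog 2 n) (Nat.clog 2 B.card) A B (by omega) htn hAmem hBmem
    (Nat.le_pow_clog (by norm_num) _) (pair_lt_two_pow (by omega) hKn htn) x hxB
  have hKS' : (KS U x : ℝ) ≤ Nat.clog 2 B.card + 2 * (14 * Nat.clog 2 n) + c := by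
    exact_mod_cast hKS
  have hclB := clog_mul_log_two_le hBne.card_pos
  have hcln : (Nat.clog 2 n : ℝ) ≤ L + 1 := by
    have := clog_mul_log_two_le (b := n) (by omega)
    rw [hLlog] at this
    exact le_of_mul_le_mul_right (by linarith) hl2
  have hBlarge : n * Real.binEntropy p - Real.log B.card ≤ (57 * L + c) * Real.log 2 := by
    have h1 : entropyBits p * n * Real.log 2
        ≤ (Nat.clog 2 B.card + 2 * (14 * Nat.clog 2 n) + c) * Real.log 2 :=
      mul_le_mul_of_nonneg_right (hx.trans hKS') hl2.le
    have h2 : (Nat.clog 2 n : ℝ) * Real.log 2 ≤ (L + 1) * Real.log 2 :=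
      mul_le_mul_of_nonneg_right hcln hl2.le
    have h3 : entropyBits p * n * Real.log 2 = n * Real.binEntropy p := by rw [← hα]; ring
    have h4 : Real.log 2 ≤ L * Real.log 2 := le_mul_of_one_le_left hl2.le hL1
    linarith
  obtain ⟨r, hr2, hrE⟩ := exists_blowup_radius hn
  rw [← hL, ← hE] at hrE
  have hmain := log_card_noisy_preimage_le (s := s) hτ0.le hτ1.le
    (κ := Real.binEntropy (noiseParam p τ) - s * Real.binEntropy p)
    (fun r hr => by have := hs r hr; linarith) (by omega) hBne hAB hr2
  have hlogA : Real.log A.card ≤ K * Real.log 2 := by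
    have h1 := hU.card_KS_lt A fun y hy => (hAmem y).1 hy
    rcases Nat.eq_zero_or_pos A.card with h0 | h0
    · rw [h0]; simp; positivity
    · rw [← Real.log_pow]
      exact Real.log_le_log (by exact_mod_cast h0) (by exact_mod_cast h1.le)
  have hA0 : 0 < A.card := by
    by_contra h0
    have : A = ∅ := Finset.card_eq_zero.1 (by omega)
    rw [this] at hgt
    norm_num at hgt
  have hKθ : (K : ℝ) ≤ θ + 1 := by
    have hKpos : 0 < K := by
      obtain ⟨y, hy⟩ := Finset.card_pos.1 hA0
      have := (hAmem y).1 hy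
      omega
    exact (Nat.ceil_lt_add_one (Nat.ceil_pos.1 hKpos).le).le
  have hsB : s * (n * Real.binEntropy p - Real.log B.card) ≤ (57 * L + c) * Real.log 2 := by
    have h0 : 0 ≤ (57 * L + c) * Real.log 2 := by positivity
    nlinarith
  have hKlog : K * Real.log 2 ≤ n * Real.binEntropy (noiseParam p τ)
      - (72 + c) * E * Real.log 2 + Real.log 2 := by
    have := mul_le_mul_of_nonneg_right hKθ hl2.le
    rw [hθ] at this
    rw [← hβ]
    linarith
  have hfinal : (72 + c) * E * Real.log 2 ≤ (57 * L + c + 8 * E + 7) * Real.log 2 := by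
    linarith
  have hfin := le_of_mul_le_mul_right hfinal hl2
  have hcE : (c : ℝ) ≤ c * E := le_mul_of_one_le_right (Nat.cast_nonneg c) (hL1.trans hEL.le)
  -- now `72 E ≤ 57 L + 8 E + 7 < 72 E`
  have hLE : 1 ≤ E := hL1.trans hEL.le
  linarith

/-! ### Optimality -/

lemma sum_negMulLog_bitNoise (τ : ℝ) (a : Bool) :
    ∑ b, Real.negMulLog (bitNoise τ a b) = Real.binEntropy τ := by
  rw [Real.binEntropy_eq_negMulLog_add_negMulLog_one_sub]
  cases a <;> simp [bitNoise, add_comm]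

/-- The entropy of `n` independent noisy bits. -/
lemma sum_negMulLog_noiseWeight (τ : ℝ) : ∀ {n : ℕ} (x : Fin n → Bool),
    ∑ y, Real.negMulLog (noiseWeight τ x y) = n * Real.binEntropy τ := by
  intro n
  induction n with
  | zero => intro x; simp [noiseWeight]
  | succ n ih =>
    intro x
    obtain ⟨a, x, rfl⟩ : ∃ a x', x = (Fin.cons a x' : Fin (n + 1) → Bool) :=
      ⟨x 0, Fin.tail x, (Fin.cons_self_tail x).symm⟩
    rw [sum_cube_succ]
    simp_rw [noiseWeight_cons, Real.negMulLog_mul, Finset.sum_add_distrib, ← Finset.sum_mul,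
      ← Finset.mul_sum, ih, sum_noiseWeight, one_mul, ← Finset.sum_mul, sum_bitNoise,
      sum_negMulLog_bitNoise]
    push_cast
    ring

/-- Noise of level `p` followed by noise of level `τ` is noise of level `N (p, τ)`. -/
lemma noisy_noiseWeight (p τ : ℝ) {n : ℕ} (x y : Fin n → Bool) :
    noisy τ (noiseWeight p x) y = noiseWeight (noiseParam p τ) x y := by
  unfold noisy
  simp only [noiseWeight_eq_prod, ← Finset.prod_mul_distrib]
  rw [← Fintype.prod_sum (fun i b => bitNoise p (x i) b * bitNoise τ b (y i))]
  refine Finset.prod_congr rfl fun i _ => ?_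
  cases x i <;> cases y i <;> simp [bitNoise, noiseParam] <;> ring

lemma noiseWeight_zero_eq (q : ℝ) {n : ℕ} (y : Fin n → Bool) :
    noiseWeight q (fun _ => false) y = (1 - q) ^ (n - ones y) * q ^ ones y := by
  have h1 : (Finset.univ.filter fun i => y i = true).card = ones y := by
    rw [Finset.card_filter]; rfl
  have h2 := Finset.card_filter_add_card_filter_not (s := (Finset.univ : Finset (Fin n)))
    (fun i => y i = true)
  rw [h1, Finset.card_univ, Fintype.card_fin] at h2
  have h3 : (Finset.univ.filter fun i => ¬ y i = true).card = n - ones y := by omega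
  have h4 : noiseWeight q (fun _ => false) y = ∏ i, if y i = true then q else 1 - q :=
    Finset.prod_congr rfl fun i _ => by cases y i <;> simp
  rw [h4, Finset.prod_ite, Finset.prod_const, Finset.prod_const, h1, h3, mul_comm]

lemma ones_le {n : ℕ} (y : Fin n → Bool) : ones y ≤ n := by
  unfold ones
  refine (Finset.sum_le_card_nsmul _ _ 1 fun i _ => ?_).trans (by simp)
  split_ifs <;> simp

/-- The complexity of a string is at most its information content with respect to the Bernoulli
distribution, up to a logarithmic term. -/
theorem IsOptimalDecompressor.KS_le_neg_log {U : List Bool →. List Bool}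
    (hU : IsOptimalDecompressor U) :
    ∃ c : ℕ, ∀ n : ℕ, 2 ≤ n → ∀ q : ℝ, 0 < q → q < 1 → ∀ y : Fin n → Bool,
      KS U y * Real.log 2 ≤ -Real.log (noiseWeight q (fun _ => false) y)
        + (8 * Nat.clog 2 n + c) * Real.log 2 := by
  classical
  obtain ⟨c, hc⟩ := hU.KS_le_of_ones
  refine ⟨c + 1, fun n hn q hq0 hq1 y => ?_⟩
  set S : Finset (Fin n → Bool) := Finset.univ.filter fun z => ones z = ones y with hS
  have hyS : y ∈ S := by simp [hS]
  have hpair : Nat.pair n (ones y) < 2 ^ (4 * Nat.clog 2 n) := by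
    refine (Nat.pair_lt_max_add_one_sq _ _).trans_le ?_
    rw [max_eq_left (ones_le y)]
    calc (n + 1) ^ 2 ≤ (n ^ 2) ^ 2 := Nat.pow_le_pow_left (by nlinarith) 2
      _ = n ^ 4 := by ring
      _ ≤ (2 ^ Nat.clog 2 n) ^ 4 := Nat.pow_le_pow_left (Nat.le_pow_clog (by norm_num) n) 4
      _ = 2 ^ (4 * Nat.clog 2 n) := by rw [← pow_mul, mul_comm]
  have h1 := hc n (ones y) _ _ (Nat.le_pow_clog (by norm_num) S.card) hpair y rfl
  have h1' : (KS U y : ℝ) ≤ Nat.clog 2 S.card + 2 * (4 * Nat.clog 2 n) + c := by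
    exact_mod_cast h1
  have hS0 : 0 < S.card := Finset.card_pos.2 ⟨y, hyS⟩
  have hw : 0 < noiseWeight q (fun _ => false) y := by
    rw [noiseWeight_zero_eq]
    have : 0 < 1 - q := by linarith
    positivity
  -- the strings in `S` are equally likely
  have h2 : (S.card : ℝ) * noiseWeight q (fun _ => false) y ≤ 1 := by
    calc (S.card : ℝ) * noiseWeight q (fun _ => false) y
        = ∑ z ∈ S, noiseWeight q (fun _ => false) z := by
          rw [← nsmul_eq_mul, ← Finset.sum_const]
          refine Finset.sum_congr rfl fun z hz => ?_
          rw [noiseWeight_zero_eq, noiseWeight_zero_eq, (Finset.mem_filter.1 hz).2]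
      _ ≤ ∑ z, noiseWeight q (fun _ => false) z :=
          Finset.sum_le_univ_sum_of_nonneg fun z => noiseWeight_nonneg hq0.le hq1.le _ z
      _ = 1 := sum_noiseWeight _ _
  have h3 : Real.log S.card + Real.log (noiseWeight q (fun _ => false) y) ≤ 0 := by
    rw [← Real.log_mul (by exact_mod_cast hS0.ne') hw.ne']
    exact Real.log_nonpos (by positivity) h2
  have h4 := clog_mul_log_two_le hS0
  have hl2 := Real.log_pos one_lt_two
  have h5 := mul_le_mul_of_nonneg_right h1' hl2.le
  push_cast
  linarith

lemma tendsto_logb_div : Tendsto (fun n : ℕ => Real.logb 2 n / n) atTop (𝓝 0) := by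
  have h := (Real.isLittleO_log_id_atTop.tendsto_div_nhds_zero).comp
    (tendsto_natCast_atTop_atTop (R := ℝ))
  have h2 := h.div_const (Real.log 2)
  rw [zero_div] at h2
  refine h2.congr fun n => ?_
  simp only [Function.comp, id, Real.logb]
  ring

lemma tendsto_errorTerm_div :
    Tendsto (fun n : ℕ => (Real.sqrt n * Real.logb 2 n ^ (3 / 2 : ℝ)) / n) atTop (𝓝 0) := by
  have h := ((isLittleO_log_rpow_rpow_atTop (3 / 2) (show (0 : ℝ) < 1 / 2 by norm_num)
    ).tendsto_div_nhds_zero).comp (tendsto_natCast_atTop_atTop (R := ℝ))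
  have h2 := h.div_const (Real.log 2 ^ (3 / 2 : ℝ))
  rw [zero_div] at h2
  refine h2.congr' ?_
  filter_upwards [eventually_ge_atTop 1] with n hn
  have hn' : (1 : ℝ) ≤ n := by exact_mod_cast hn
  have hn0 : (0 : ℝ) < n := by linarith
  have hl2 := Real.log_pos one_lt_two
  simp only [Function.comp, Real.logb]
  rw [Real.div_rpow (Real.log_nonneg hn') hl2.le, ← Real.sqrt_eq_rpow]
  have h3 : 0 < Real.log 2 ^ (3 / 2 : ℝ) := Real.rpow_pos_of_pos hl2 _
  have h4 : 0 < Real.sqrt n := Real.sqrt_pos.2 hn0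
  rw [div_div, div_eq_div_iff (by positivity) (by positivity)]
  field_simp
  rw [Real.sq_sqrt hn0.le]

lemma noiseProb_mono {τ : ℝ} (hτ0 : 0 ≤ τ) (hτ1 : τ ≤ 1) {n : ℕ} (x : Fin n → Bool)
    {E F : Set (Fin n → Bool)} (h : E ⊆ F) : noiseProb τ x E ≤ noiseProb τ x F :=
  Finset.sum_le_sum fun y _ => Set.indicator_le_indicator_of_subset h
    (fun y => noiseWeight_nonneg hτ0 hτ1 x y) y

/-- If noise of level `p` leads from `x` to `G` and noise of level `τ` leads from each point of `G`
to `E`, each with probability at least `1 - δ`, then the composition leads from `x` to `E` with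
probability at least `1 - 2 δ`. -/
lemma noiseProb_noiseParam_ge {p τ δ : ℝ} (hp0 : 0 ≤ p) (hp1 : p ≤ 1) (hτ0 : 0 ≤ τ) (hτ1 : τ ≤ 1)
    (hδ : δ ≤ 1) {n : ℕ} (x : Fin n → Bool) {G E : Set (Fin n → Bool)}
    (hG : 1 - δ ≤ noiseProb p x G) (hE : ∀ z ∈ G, 1 - δ ≤ noiseProb τ z E) :
    1 - 2 * δ ≤ noiseProb (noiseParam p τ) x E := by
  classical
  have h1 : noiseProb (noiseParam p τ) x E = ∑ z, noiseWeight p x z * noiseProb τ z E := by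
    unfold noiseProb
    simp_rw [Set.indicator_apply, ← noisy_noiseWeight, noisy, Finset.mul_sum]
    rw [Finset.sum_comm]
    refine Finset.sum_congr rfl fun y _ => ?_
    split_ifs <;> simp
  have h2 : noiseProb p x G * (1 - δ) ≤ ∑ z, noiseWeight p x z * noiseProb τ z E := by
    unfold noiseProb
    rw [Finset.sum_mul]
    refine Finset.sum_le_sum fun z _ => ?_
    by_cases hz : z ∈ G
    · rw [Set.indicator_of_mem hz]
      exact mul_le_mul_of_nonneg_left (hE z hz) (noiseWeight_nonneg hp0 hp1 _ _)
    · rw [Set.indicator_of_notMem hz, zero_mul]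
      exact mul_nonneg (noiseWeight_nonneg hp0 hp1 _ _) (Finset.sum_nonneg fun y _ =>
        Set.indicator_nonneg (fun y _ => noiseWeight_nonneg hτ0 hτ1 _ _) y)
  rw [h1]
  nlinarith [mul_le_mul_of_nonneg_right hG (sub_nonneg.2 hδ), sq_nonneg δ]

/-- A lower bound for the complexity of typical strings of a Bernoulli distribution is a lower
bound for their mean complexity, and hence for the entropy. -/
lemma mul_prob_le_entropy {U : List Bool →. List Bool} {n c : ℕ} {q θ : ℝ} (hq0 : 0 < q)
    (hq1 : q < 1) (hc : ∀ y : Fin n → Bool,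
      KS U y * Real.log 2 ≤ -Real.log (noiseWeight q (fun _ => false) y)
        + (8 * Nat.clog 2 n + c) * Real.log 2) {δ : ℝ} (hδ : δ ≤ 1)
    (h : 1 - δ ≤ noiseProb q (fun _ => false) {y : Fin n → Bool | θ ≤ (KS U y : ℝ)}) :
    θ * (1 - δ) ≤ entropyBits q * n + (8 * Nat.clog 2 n + c) := by
  classical
  have hl2 := Real.log_pos one_lt_two
  have hw := noiseWeight_nonneg hq0.le hq1.le (fun _ : Fin n => false)
  have hmean : (∑ y, noiseWeight q (fun _ : Fin n => false) y * KS U y) * Real.log 2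
      ≤ (entropyBits q * n + (8 * Nat.clog 2 n + c)) * Real.log 2 := by
    calc (∑ y, noiseWeight q (fun _ : Fin n => false) y * KS U y) * Real.log 2
        = ∑ y, noiseWeight q (fun _ : Fin n => false) y * (KS U y * Real.log 2) := by
          rw [Finset.sum_mul]
          exact Finset.sum_congr rfl fun y _ => mul_assoc _ _ _
      _ ≤ ∑ y, (Real.negMulLog (noiseWeight q (fun _ : Fin n => false) y)
            + noiseWeight q (fun _ : Fin n => false) y
              * ((8 * Nat.clog 2 n + c) * Real.log 2)) := by
          refine Finset.sum_le_sum fun y _ => ?_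
          have := mul_le_mul_of_nonneg_left (hc y) (hw y)
          rw [Real.negMulLog]
          linarith
      _ = (entropyBits q * n + (8 * Nat.clog 2 n + c)) * Real.log 2 := by
          rw [Finset.sum_add_distrib, sum_negMulLog_noiseWeight, ← Finset.sum_mul,
            sum_noiseWeight]
          unfold entropyBits
          field_simp
  have hmean' := le_of_mul_le_mul_right hmean hl2
  have hnn : 0 ≤ ∑ y, noiseWeight q (fun _ : Fin n => false) y * KS U y :=
    Finset.sum_nonneg fun y _ => mul_nonneg (hw y) (Nat.cast_nonneg _)
  rcases le_or_gt θ 0 with hθ | hθ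
  · nlinarith
  · refine le_trans ?_ hmean'
    refine (mul_le_mul_of_nonneg_left h hθ.le).trans ?_
    unfold noiseProb
    rw [Finset.mul_sum]
    refine Finset.sum_le_sum fun y _ => ?_
    rw [Set.indicator_apply]
    split_ifs with hy
    · rw [mul_comm]
      exact mul_le_mul_of_nonneg_left hy (hw y)
    · rw [mul_zero]
      exact mul_nonneg (hw y) (Nat.cast_nonneg _)

/-- Optimality for fair random strings, which have maximal complexity. -/
lemma IsOptimalDecompressor.le_one_of_noise_bound {U : List Bool →. List Bool}
    (hU : IsOptimalDecompressor U) {τ β : ℝ} {f : ℕ → ℝ}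
    (hf : Tendsto (fun n : ℕ => f n / (n : ℝ)) atTop (𝓝 0))
    (h : ∀ᶠ n : ℕ in atTop, ∀ x : Fin n → Bool, (n : ℝ) ≤ (KS U x : ℝ) →
      1 - 1 / (n : ℝ) ≤ noiseProb τ x {y : Fin n → Bool | β * (n : ℝ) - f n ≤ (KS U y : ℝ)}) :
    β ≤ 1 := by
  classical
  obtain ⟨c, hc⟩ := hU.plainComplexity_le_length
  have hlim : Tendsto (fun n : ℕ => 1 + (c : ℝ) / n + f n / n) atTop (𝓝 (1 + 0 + 0)) :=
    (tendsto_const_nhds.add (tendsto_const_div_atTop_nhds_zero_nat (c : ℝ))).add hf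
  rw [add_zero, add_zero] at hlim
  refine ge_of_tendsto hlim ?_
  filter_upwards [h, eventually_ge_atTop 2] with n hn hn2
  have hn' : (2 : ℝ) ≤ n := by exact_mod_cast hn2
  have hn0 : (0 : ℝ) < n := by linarith
  obtain ⟨x, hx⟩ : ∃ x : Fin n → Bool, n ≤ KS U x := by
    by_contra! hcon
    have := hU.card_KS_lt Finset.univ fun y _ => hcon y
    simp at this
  have hp := hn x (by exact_mod_cast hx)
  have hpos : 1 / (n : ℝ) < 1 := by rw [div_lt_one hn0]; linarith
  obtain ⟨y, hy⟩ : {y : Fin n → Bool | β * (n : ℝ) - f n ≤ (KS U y : ℝ)}.Nonempty := by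
    rw [Set.nonempty_iff_ne_empty]
    intro he
    rw [he] at hp
    simp only [noiseProb, Set.indicator_empty, Finset.sum_const_zero] at hp
    linarith
  have hy' : β * (n : ℝ) - f n ≤ (KS U y : ℝ) := hy
  have hyc : (KS U y : ℝ) ≤ n + c := by
    have := hc (List.ofFn y)
    rw [List.length_ofFn] at this
    exact_mod_cast this
  have e : 1 + (c : ℝ) / n + f n / n = (n + c + f n) / n := by field_simp
  rw [e, le_div_iff₀ hn0]
  linarith

/-- Optimality of the bound, with a slightly larger parameter `p'`: strings from the Bernoulli
distribution with parameter `p'` mostly have the required complexity, and the noise turns them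
into strings from the Bernoulli distribution with parameter `N (p', τ)`. -/
lemma IsOptimalDecompressor.le_entropyBits_of_noise_bound {U : List Bool →. List Bool}
    (hU : IsOptimalDecompressor U) {p p' τ β : ℝ} {f : ℕ → ℝ} (hp0 : 0 ≤ p) (hpp : p < p')
    (hp1 : p' < 1 / 2) (hτ0 : 0 < τ) (hτ1 : τ < 1)
    (hf : Tendsto (fun n : ℕ => f n / (n : ℝ)) atTop (𝓝 0))
    (h : ∀ᶠ n : ℕ in atTop, ∀ x : Fin n → Bool, entropyBits p * (n : ℝ) ≤ (KS U x : ℝ) →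
      1 - 1 / (n : ℝ) ≤ noiseProb τ x {y : Fin n → Bool | β * (n : ℝ) - f n ≤ (KS U y : ℝ)}) :
    β ≤ entropyBits (noiseParam p' τ) := by
  classical
  have hl2 := Real.log_pos one_lt_two
  obtain ⟨c, hc⟩ := hU.KS_le_neg_log
  obtain ⟨d, hd⟩ := hU.exists_noise_bound
  have hp'0 : 0 < p' := hp0.trans_lt hpp
  have hq := noiseParam_mem_Ioo (r := p') (τ := τ) ⟨hp'0.le, by linarith⟩ ⟨hτ0, hτ1⟩
  have hent : entropyBits p < entropyBits p' :=
    div_lt_div_of_pos_right (Real.binEntropy_strictMonoOn ⟨hp0, by norm_num; linarith⟩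
      ⟨hp'0.le, by norm_num; linarith⟩ hpp) hl2
  have herr := (tendsto_errorTerm_div.const_mul d).eventually_lt_const
    (show d * 0 < entropyBits p' - entropyBits p by linarith)
  have hlim1 : Tendsto (fun n : ℕ => (β - f n / n) * (1 - 2 / n)) atTop (𝓝 ((β - 0) * (1 - 0))) :=
    (tendsto_const_nhds.sub hf).mul
      (tendsto_const_nhds.sub (tendsto_const_div_atTop_nhds_zero_nat (2 : ℝ)))
  have hlim2 : Tendsto (fun n : ℕ => entropyBits (noiseParam p' τ)
      + (8 * (Real.logb 2 n / n) + ((8 + c : ℕ) : ℝ) / n)) atTop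
      (𝓝 (entropyBits (noiseParam p' τ) + (8 * 0 + 0))) :=
    tendsto_const_nhds.add ((tendsto_logb_div.const_mul 8).add
      (tendsto_const_div_atTop_nhds_zero_nat _))
  simp only [sub_zero, mul_one, mul_zero, add_zero] at hlim1 hlim2
  refine le_of_tendsto_of_tendsto hlim1 hlim2 ?_
  filter_upwards [h, herr, hd 0 p' le_rfl (by norm_num) hp'0 (by linarith),
    eventually_ge_atTop 2] with n hn herr hd hn2
  have hn' : (2 : ℝ) ≤ n := by exact_mod_cast hn2
  have hn0 : (0 : ℝ) < n := by linarith
  have hG := hd (fun _ => false) (by simp [entropyBits])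
  rw [show noiseParam 0 p' = p' by simp [noiseParam]] at hG
  have hG' := hG.trans (noiseProb_mono hp'0.le (by linarith) _
    (F := {z : Fin n → Bool | entropyBits p * (n : ℝ) ≤ (KS U z : ℝ)}) fun z hz => by
      have hz' : entropyBits p' * (n : ℝ)
        - d * (Real.sqrt (n : ℝ) * Real.logb 2 (n : ℝ) ^ (3 / 2 : ℝ)) ≤ (KS U z : ℝ) := hz
      show entropyBits p * (n : ℝ) ≤ (KS U z : ℝ)
      rw [← mul_div_assoc, div_lt_iff₀ hn0] at herr
      linarith)
  have hE := noiseProb_noiseParam_ge hp'0.le (by linarith) hτ0.le hτ1.le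
    (by rw [div_le_one hn0]; linarith) _ hG' fun z hz => hn z hz
  have hfin := mul_prob_le_entropy hq.1 hq.2 (hc n hn2 _ hq.1 hq.2)
    (by rw [← mul_div_assoc, div_le_one hn0]; linarith) hE
  have hclog : (Nat.clog 2 n : ℝ) ≤ Real.logb 2 n + 1 := by
    have := clog_mul_log_two_le (b := n) (by omega)
    rw [Real.logb, ← sub_le_iff_le_add, le_div_iff₀ hl2]
    linarith
  have e1 : (β - f n / n) * (1 - 2 / n) = (β * n - f n) * (1 - 2 * (1 / n)) / n := by
    field_simp
  have e2 : entropyBits (noiseParam p' τ) + (8 * (Real.logb 2 n / n) + ((8 + c : ℕ) : ℝ) / n)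
      = (entropyBits (noiseParam p' τ) * n + (8 * (Real.logb 2 n + 1) + c)) / n := by
    push_cast; field_simp; ring
  rw [e1, e2]
  gcongr
  linarith

end

theorem theorem2 (U : List Bool →. List Bool) (hU : IsOptimalDecompressor U) :
    -- the bound, with an error term whose constant depends on neither `p` nor `τ`
    (∃ c : ℝ, ∀ p τ : ℝ, 0 ≤ p → p ≤ 1 / 2 → 0 < τ → τ < 1 →
      ∀ᶠ n : ℕ in atTop, ∀ x : Fin n → Bool,
        entropyBits p * (n : ℝ) ≤ (KS U x : ℝ) →
          1 - 1 / (n : ℝ) ≤ noiseProb τ x {y : Fin n → Bool |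
            entropyBits (noiseParam p τ) * (n : ℝ)
              - c * (Real.sqrt (n : ℝ) * Real.logb 2 (n : ℝ) ^ (3 / 2 : ℝ)) ≤ (KS U y : ℝ)}) ∧
    -- optimality: no larger `β` has this property, whatever the error term `o(n)`
    (∀ p τ : ℝ, 0 ≤ p → p ≤ 1 / 2 → 0 < τ → τ < 1 →
      ∀ (β : ℝ) (f : ℕ → ℝ), Tendsto (fun n : ℕ => f n / (n : ℝ)) atTop (𝓝 0) →
        (∀ᶠ n : ℕ in atTop, ∀ x : Fin n → Bool,
          entropyBits p * (n : ℝ) ≤ (KS U x : ℝ) →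
            1 - 1 / (n : ℝ) ≤ noiseProb τ x {y : Fin n → Bool |
              β * (n : ℝ) - f n ≤ (KS U y : ℝ)}) →
        β ≤ entropyBits (noiseParam p τ)) := by
  refine ⟨hU.exists_noise_bound, fun p τ hp0 hp1 hτ0 hτ1 β f hf h => ?_⟩
  rcases hp1.eq_or_lt with rfl | hp1
  · have e : entropyBits (1 / 2) = 1 := by
      rw [entropyBits, one_div, Real.binEntropy_two_inv, div_self (Real.log_pos one_lt_two).ne']
    rw [show noiseParam (1 / 2) τ = 1 / 2 by unfold noiseParam; ring, e]
    refine hU.le_one_of_noise_bound (τ := τ) hf ?_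
    simpa only [e, one_mul] using h
  · have hcont : Continuous fun r : ℝ => entropyBits (noiseParam r τ) := by
      unfold entropyBits noiseParam
      fun_prop
    refine ge_of_tendsto ((hcont.tendsto p).mono_left (nhdsWithin_le_nhds (s := Set.Ioi p))) ?_
    filter_upwards [Ioo_mem_nhdsGT hp1] with p' hp'
    exact hU.le_entropyBits_of_noise_bound hp0 hp'.1 hp'.2 hτ0 hτ1 hf h
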